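/- Let $\mathbb{D}$ be the open unit disk. For functions $g,F$ on $\mathbb{D}$ write $g\prec F$ if $g=F\circ w$ for some analytic $w:\mathbb{D}\to\mathbb{D}$ with $w(0)=0$. Let $-1\le E<D\le 1$ and $\psi(z)=(1+Dz)/(1+Ez)$. Let $\mathcal{S}^*(\psi)$ be the class of analytic $f(z)=z+\sum_{n\ge 2}a_nz^n$ on $\mathbb{D}$ with $zf'(z)/f(z)\prec\psi(z)$, and for $f\in\mathcal{S}^*(\psi)$ let $S_f(\psi)$ be the class of analytic $g(z)=\sum_{k\ge 1}b_kz^k$ on $\mathbb{D}$ with $g\prec f$. For $0<\rho\le 1$ say that the classes $S_f(\psi)$ satisfy the Bohr phenomenon for $r\le\rho$ if $$\sum_{k=1}^{\infty}|b_k|r^k\le d\big(f(0),\partial f(\mathbb{D})\big)\qquad\text{for all } f\in\mathcal{S}^*(\psi),\ g=\sum_{k\ge1} b_kz^k\in S_f(\psi),\ 0\le r\le\rho,\ r<1,$$ and that $\mathcal{S}^*(\psi)$ does if $r+\sum_{n\ge2}|a_n|r^n\le d(f(0),\partial f(\mathbb{D}))$ for all $f\in\mathcal{S}^*(\psi)$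 and all such $r$; here $d$ is Euclidean distance. Put $$f_0(z)=z(1+Ez)^{\frac{D-E}{E}}\ \ (E\ne0,\text{ principal branch}),\qquad f_0(z)=ze^{Dz}\ \ (E=0),$$ and $f_0(z)=z+\sum_{n\ge2}t_nz^n$. (i) If $E=0$ and $D\ge\frac34\log 3$, then the equation $1-re^{D(1+r)}=0$ has exactly one real root $r_0$, and $r_0\in(0,1)$. (ii) If $E\neq0$, $t_n\ge0$ for all $n\ge2$, and $3(1-E)^{\frac{D-E}{E}}\le(1+E/3)^{\frac{D-E}{E}}$, then the equation $(1-E)^{\frac{D-E}{E}}-r(1+Er)^{\frac{D-E}{E}}=0$ has exactly one root $r_0$ among the real $r$ with $1+Er>0$, and $r_0\in(0,1)$. In both cases the classes $S_f(\psi)$, and also $\mathcal{S}^*(\psi)$, satisfy the Bohr phenomenon for $r\le r_0$. The result is sharp: in both instances $r_0$ is the largest number in $(0,1]$ with this property. Moreover $f_0\in\mathcal{S}^*(\psi)$, and for $f=g=f_0$ the inequality is an equality at $r=r_0$ and fails for every $r\in(r_0,1)$. -/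

import Mathlib

namespace JanowskiBohr

/-- The open unit disk. -/
abbrev unitDisk : Set ℂ := Metric.ball (0 : ℂ) 1

/-- `g ≺ F` on the unit disk: `g = F ∘ w` on the disk for some analytic self-map `w` of the disk
with `w 0 = 0`. Functions on the disk are represented by functions on `ℂ`, and their
values outside the disk are irrelevant. -/
def Subordinate (g F : ℂ → ℂ) : Prop :=
  ∃ w : ℂ → ℂ, DifferentiableOn ℂ w unitDisk ∧ w 0 = 0 ∧
    (∀ z ∈ unitDisk, w z ∈ unitDisk) ∧ ∀ z ∈ unitDisk, g z = F (w z)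

/-- The class of functions analytic in the disk of the form `z + a₂ z² + ⋯`. -/
def classA : Set (ℂ → ℂ) :=
  {f | DifferentiableOn ℂ f unitDisk ∧ f 0 = 0 ∧ deriv f 0 = 1}

open Classical in
/-- The function `z f'(z) / f(z)`, with its removable singularity at the origin filled in
(for `f` in `classA` the limit at `0` is `1`). -/
noncomputable def logDerivQuotient (f : ℂ → ℂ) (z : ℂ) : ℂ :=
  if z = 0 then 1 else z * deriv f z / f z

/-- The Ma-Minda class `S*(ψ)`: those `f` in `classA` for which `z f'(z) / f(z)` is an analytic
function on the disk (so `f` has no zero other than the origin) subordinate to `ψ`. -/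
def starlikeClass (ψ : ℂ → ℂ) : Set (ℂ → ℂ) :=
  {f | f ∈ classA ∧ (∀ z ∈ unitDisk, z ≠ 0 → f z ≠ 0) ∧ Subordinate (logDerivQuotient f) ψ}

/-- The class `S_f(ψ)` of analytic functions on the disk subordinate to a given
`f ∈ S*(ψ)`. As `f 0 = 0`, its members have the form `b₁ z + b₂ z² + ⋯`. -/
def subordinants (f : ℂ → ℂ) : Set (ℂ → ℂ) :=
  {g | DifferentiableOn ℂ g unitDisk ∧ Subordinate g f}

/-- The `k`-th Taylor coefficient at the origin. -/
noncomputable def taylorCoeff (g : ℂ → ℂ) (k : ℕ) : ℂ :=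
  iteratedDeriv k g 0 / (k.factorial : ℂ)

/-- The majorant series `∑_{k ≥ 1} |b_k| r ^ k` of `g = ∑ b_k z ^ k`, as a real number. -/
noncomputable def majorant (g : ℂ → ℂ) (r : ℝ) : ℝ :=
  ∑' k : ℕ, ‖taylorCoeff g (k + 1)‖ * r ^ (k + 1)

/-- The Euclidean distance from `f 0` to the boundary of the image of the disk under `f`. -/
noncomputable def boundaryDist (f : ℂ → ℂ) : ℝ :=
  Metric.infDist (f 0) (frontier (f '' unitDisk))

/-- The family `𝒢` satisfies the Bohr phenomenon relative to `f` for `|z| = r ≤ ρ`: for each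
`g ∈ 𝒢` the majorant series converges and is at most `d(f(0), ∂ f(𝔻))`. -/
def BohrPhenomenon (f : ℂ → ℂ) (𝒢 : Set (ℂ → ℂ)) (ρ : ℝ) : Prop :=
  ∀ g ∈ 𝒢, ∀ z ∈ unitDisk, ‖z‖ ≤ ρ →
    Summable (fun k : ℕ => ‖taylorCoeff g (k + 1)‖ * ‖z‖ ^ (k + 1)) ∧
      majorant g ‖z‖ ≤ boundaryDist f

/-- The Janowski function `(1 + D z) / (1 + E z)`. -/
noncomputable def janowskiPsi (D E : ℝ) (z : ℂ) : ℂ :=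
  (1 + (D : ℂ) * z) / (1 + (E : ℂ) * z)

open Classical in
/-- The function `f₀` of the Janowski class. The power is the principal one; on the unit
disk `1 + E z` lies in the right half-plane when `|E| ≤ 1`. -/
noncomputable def janowskiExtremal (D E : ℝ) (z : ℂ) : ℂ :=
  if E = 0 then z * Complex.exp ((D : ℂ) * z)
  else z * (1 + (E : ℂ) * z) ^ (((D - E) / E : ℝ) : ℂ)

/-- For `f ∈ S*(ψ)`, both `S_f(ψ)` and `S*(ψ)` satisfy the Bohr phenomenon for `r ≤ r₀`, and
`r₀` is the largest radius in `(0, 1]` with that property (the Bohr radius), in each of the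
two cases; moreover `f₀ ∈ S*(ψ)` is extremal: with `f = g = f₀` the inequality is an equality
at `r₀` and fails at every `r ∈ (r₀, 1)`. -/
def SharpBohr (ψ f₀ : ℂ → ℂ) (r₀ : ℝ) : Prop :=
  IsGreatest {ρ : ℝ | ρ ∈ Set.Ioc (0 : ℝ) 1 ∧
    ∀ f ∈ starlikeClass ψ, BohrPhenomenon f (subordinants f) ρ} r₀ ∧
  IsGreatest {ρ : ℝ | ρ ∈ Set.Ioc (0 : ℝ) 1 ∧
    ∀ f ∈ starlikeClass ψ, BohrPhenomenon f {f} ρ} r₀ ∧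
  f₀ ∈ starlikeClass ψ ∧
  majorant f₀ r₀ = boundaryDist f₀ ∧
  ∀ r ∈ Set.Ioo r₀ 1, boundaryDist f₀ < majorant f₀ r

end JanowskiBohr

/-!
If `f ∈ S*(ψ)` then `f(z) / z` is subordinate to `f₀(z) / z`: the Schwarz function is obtained by
solving a linear differential equation, and Jack's lemma keeps it inside the disk. Two facts follow.
First, `|f(z)| ≥ |z| · (-f₀(-1))`, and since `Re (z f' / f) > 0` makes `f` univalent with open
image, the boundary of `f(𝔻)` lies at distance at least `-f₀(-1)` from `0`, with equality for `f₀`.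
Secondly, for `r ≤ 1/3` Bohr's inequality shows that subordination cannot increase the majorant
series, so those of `g ≺ f` and of `f` are bounded by that of `f₀`, which is `f₀(r)` when the
coefficients of `f₀` are nonnegative. The radius is therefore the root of `f₀(r) = -f₀(-1)`, and the
numerical hypotheses say exactly that this root is at most `1/3`.
-/

namespace JanowskiBohr

open Complex Metric Filter Topology

section TaylorCoefficients

theorem unitDisk_mem_nhds_zero : unitDisk ∈ 𝓝 (0 : ℂ) := ball_mem_nhds 0 one_pos

theorem analyticAt_zero_of_differentiableOn {F : ℂ → ℂ} (hF : DifferentiableOn ℂ F unitDisk) :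
    AnalyticAt ℂ F 0 :=
  hF.analyticAt unitDisk_mem_nhds_zero

theorem taylorCoeff_zero (F : ℂ → ℂ) : taylorCoeff F 0 = F 0 := by
  simp [taylorCoeff]

theorem taylorCoeff_congr {F G : ℂ → ℂ} (h : Set.EqOn F G unitDisk) :
    taylorCoeff F = taylorCoeff G := by
  funext k
  rw [taylorCoeff, taylorCoeff,
    (h.eventuallyEq_of_mem unitDisk_mem_nhds_zero).iteratedDeriv_eq]

theorem taylorCoeff_const_mul (c : ℂ) (F : ℂ → ℂ) (k : ℕ) :
    taylorCoeff (fun z => c * F z) k = c * taylorCoeff F k := by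
  simp [taylorCoeff, iteratedDeriv_const_mul_field, mul_div_assoc]

theorem taylorCoeff_mul {F G : ℂ → ℂ} (hF : AnalyticAt ℂ F 0) (hG : AnalyticAt ℂ G 0) (k : ℕ) :
    taylorCoeff (fun z => F z * G z) k =
      ∑ i ∈ Finset.range (k + 1), taylorCoeff F i * taylorCoeff G (k - i) := by
  rw [taylorCoeff, iteratedDeriv_fun_mul hF.contDiffAt hG.contDiffAt, Finset.sum_div]
  refine Finset.sum_congr rfl fun i hi => ?_
  have hik : i ≤ k := Nat.lt_succ_iff.1 (Finset.mem_range.1 hi)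
  rw [Nat.cast_choose ℂ hik, taylorCoeff, taylorCoeff]
  field_simp [Nat.factorial_ne_zero]

theorem taylorCoeff_id_mul_succ {G : ℂ → ℂ} (hG : AnalyticAt ℂ G 0) (k : ℕ) :
    taylorCoeff (fun z => z * G z) (k + 1) = taylorCoeff G k := by
  rw [taylorCoeff_mul (F := fun z => z) analyticAt_id hG, Finset.sum_eq_single 1]
  · simp [taylorCoeff, iteratedDeriv_one]
  · intro i _ hi
    simp [taylorCoeff, iteratedDeriv_fun_id_zero, hi]
  · simp

theorem taylorCoeff_const_add {G : ℂ → ℂ} (hG : AnalyticAt ℂ G 0) (a : ℂ) {k : ℕ} (hk : k ≠ 0) :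
    taylorCoeff (fun z => a + G z) k = taylorCoeff G k := by
  simp [taylorCoeff, iteratedDeriv_fun_add contDiffAt_const hG.contDiffAt, iteratedDeriv_const, hk]

theorem hasSum_taylorCoeff {F : ℂ → ℂ} (hF : DifferentiableOn ℂ F unitDisk) {z : ℂ}
    (hz : z ∈ unitDisk) : HasSum (fun k => taylorCoeff F k * z ^ k) (F z) := by
  refine (hasSum_taylorSeries_on_ball hF hz).congr_fun fun k => ?_
  rw [taylorCoeff, sub_zero, smul_eq_mul, smul_eq_mul]
  ring

theorem summable_norm_taylorCoeff {F : ℂ → ℂ} (hF : DifferentiableOn ℂ F unitDisk) {r : ℝ}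
    (h0 : 0 ≤ r) (h1 : r < 1) : Summable fun k => ‖taylorCoeff F k‖ * r ^ k := by
  have hr : (r : ℂ) ∈ unitDisk := by simpa [abs_of_nonneg h0] using h1
  simpa [abs_of_nonneg h0] using (hasSum_taylorCoeff hF hr).summable.norm

theorem summable_norm_taylorCoeff_succ {F : ℂ → ℂ} (hF : DifferentiableOn ℂ F unitDisk) {r : ℝ}
    (h0 : 0 ≤ r) (h1 : r < 1) : Summable fun k => ‖taylorCoeff F (k + 1)‖ * r ^ (k + 1) :=
  (summable_nat_add_iff 1).2 (summable_norm_taylorCoeff hF h0 h1)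

end TaylorCoefficients

section BohrInequality

variable {F : ℂ → ℂ} {R : ℝ} {k : ℕ}

theorem circleAverage_inv_pow_mul (hF : DiffContOnCl ℂ F (ball 0 R)) (hR : 0 < R) (k : ℕ) :
    Real.circleAverage (fun z => (z ^ k)⁻¹ * F z) 0 R = taylorCoeff F k := by
  have hint : (∮ z in C(0, R), (z - 0)⁻¹ • ((z ^ k)⁻¹ * F z)) =
      ∮ z in C(0, R), (1 / (z - 0) ^ (k + 1)) • F z := by
    congr 1
    ext z
    simp only [sub_zero, smul_eq_mul, pow_succ, one_div, mul_inv]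
    ring
  rw [Real.circleAverage_eq_circleIntegral hR.ne', hint,
    hF.circleIntegral_one_div_sub_center_pow_smul hR k, smul_smul, smul_eq_mul, taylorCoeff]
  field_simp

theorem circleAverage_pow_mul (hF : DiffContOnCl ℂ F (ball 0 R)) (hR : 0 < R) (hk : k ≠ 0) :
    Real.circleAverage (fun z => z ^ k * F z) 0 R = 0 := by
  have h : DiffContOnCl ℂ (fun z => z ^ k * F z) (ball 0 |R|) := by
    rw [abs_of_pos hR]
    exact (differentiable_pow k).diffContOnCl.smul hF
  simp [h.circleAverage, hk]

theorem ofReal_re_mul_div_pow (hR : 0 < R) {z : ℂ} (hz : ‖z‖ = R) (c : ℂ) (k : ℕ) :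
    ((c * (R / z) ^ k).re : ℂ) =
      c * R ^ k / 2 * (z ^ k)⁻¹ + (starRingEnd ℂ) c / (2 * R ^ k) * z ^ k := by
  have hz0 : z ≠ 0 := norm_pos_iff.1 (hz ▸ hR)
  have hRC : (R : ℂ) ≠ 0 := by exact_mod_cast hR.ne'
  have hconj : (starRingEnd ℂ) z = (R : ℂ) ^ 2 / z := by
    rw [eq_div_iff hz0, mul_comm, mul_conj, normSq_eq_norm_sq, hz, ofReal_pow]
  rw [re_eq_add_conj]
  simp only [map_mul, map_pow, map_div₀, conj_ofReal, hconj, div_pow, pow_right_comm _ 2 k]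
  field_simp

theorem circleIntegrable_one_add_re_mul (hF : DiffContOnCl ℂ F (ball 0 R)) (hR : 0 < R) (c : ℂ)
    (k : ℕ) : CircleIntegrable (fun z => (1 + ((c * (R / z) ^ k).re : ℂ)) * F z) 0 R := by
  refine ContinuousOn.circleIntegrable hR.le ?_
  have hcont : ContinuousOn F (sphere 0 R) := hF.continuousOn_ball.mono sphere_subset_closedBall
  have hne : ∀ z ∈ sphere (0 : ℂ) R, z ≠ 0 := fun z hz => ne_of_mem_sphere hz hR.ne'
  fun_prop (disch := assumption)

/-- For `|c| = 1` the factor `1 + Re (c (R / z) ^ k)` is a nonnegative Fejér kernel. -/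
theorem circleAverage_one_add_re_mul (hF : DiffContOnCl ℂ F (ball 0 R)) (hR : 0 < R) (hk : k ≠ 0)
    (c : ℂ) :
    Real.circleAverage (fun z => (1 + ((c * (R / z) ^ k).re : ℂ)) * F z) 0 R =
      F 0 + c * R ^ k / 2 * taylorCoeff F k := by
  have hcont : ContinuousOn F (sphere 0 R) := hF.continuousOn_ball.mono sphere_subset_closedBall
  have hne : ∀ z ∈ sphere (0 : ℂ) R, z ^ k ≠ 0 := fun z hz =>
    pow_ne_zero k (ne_of_mem_sphere hz hR.ne')
  have hdiff : DiffContOnCl ℂ F (ball 0 |R|) := by rwa [abs_of_pos hR]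
  have expand : Set.EqOn (fun z => (1 + ((c * (R / z) ^ k).re : ℂ)) * F z)
      (fun z => F z + ((c * R ^ k / 2) • ((z ^ k)⁻¹ * F z) +
        ((starRingEnd ℂ) c / (2 * R ^ k)) • (z ^ k * F z))) (sphere 0 |R|) := by
    intro z hz
    have hzR : ‖z‖ = R := by simpa [abs_of_pos hR] using hz
    simp only [ofReal_re_mul_div_pow hR hzR, smul_eq_mul]
    ring
  have hint : CircleIntegrable F 0 R := hcont.circleIntegrable hR.le
  have hneg (a : ℂ) : CircleIntegrable (fun z => a • ((z ^ k)⁻¹ * F z)) 0 R :=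
    ContinuousOn.circleIntegrable hR.le (by fun_prop (disch := assumption))
  have hpos (a : ℂ) : CircleIntegrable (fun z => a • (z ^ k * F z)) 0 R :=
    ContinuousOn.circleIntegrable hR.le (by fun_prop)
  have hsum (a b : ℂ) :
      CircleIntegrable (fun z => a • ((z ^ k)⁻¹ * F z) + b • (z ^ k * F z)) 0 R :=
    (hneg a).add (hpos b)
  rw [Real.circleAverage_congr_sphere expand, Real.circleAverage_fun_add hint (hsum _ _),
    Real.circleAverage_fun_add (hneg _) (hpos _), Real.circleAverage_fun_smul,
    Real.circleAverage_fun_smul, hdiff.circleAverage, circleAverage_inv_pow_mul hF hR,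
    circleAverage_pow_mul hF hR hk]
  simp

theorem re_add_mul_taylorCoeff_nonneg (hF : DiffContOnCl ℂ F (ball 0 R)) (hR : 0 < R)
    (hre : ∀ z ∈ sphere (0 : ℂ) R, 0 ≤ (F z).re) (hk : k ≠ 0) {c : ℂ} (hc : ‖c‖ ≤ 1) :
    0 ≤ (F 0 + c * R ^ k / 2 * taylorCoeff F k).re := by
  rw [← circleAverage_one_add_re_mul hF hR hk, ← reCLM_apply,
    ← reCLM.circleAverage_comp_comm (circleIntegrable_one_add_re_mul hF hR c k)]
  refine Real.circleAverage_nonneg_of_nonneg fun z hz => ?_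
  rw [abs_of_pos hR] at hz
  have kernel_nonneg : 0 ≤ 1 + (c * (R / z) ^ k).re := by
    have hnorm : ‖c * (R / z) ^ k‖ ≤ 1 := by
      simpa [mem_sphere_zero_iff_norm.1 hz, abs_of_pos hR, hR.ne'] using hc
    linarith [neg_le_of_abs_le ((abs_re_le_norm _).trans hnorm)]
  have hmul : ((1 + ((c * (R / z) ^ k).re : ℂ)) * F z).re =
      (1 + (c * (R / z) ^ k).re) * (F z).re := by
    rw [← re_ofReal_mul, ofReal_add, ofReal_one]
  rw [Function.comp_apply, reCLM_apply, hmul]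
  exact mul_nonneg kernel_nonneg (hre z hz)

/-- Carathéodory's inequality. -/
theorem norm_taylorCoeff_le_two_mul_re (hF : DifferentiableOn ℂ F unitDisk)
    (hre : ∀ z ∈ unitDisk, 0 ≤ (F z).re) (hk : k ≠ 0) : ‖taylorCoeff F k‖ ≤ 2 * (F 0).re := by
  obtain ⟨c, hc, hca⟩ : ∃ c : ℂ, ‖c‖ = 1 ∧ c * taylorCoeff F k = -‖taylorCoeff F k‖ := by
    obtain ⟨u, hu, hua⟩ := exists_norm_eq_mul_self (taylorCoeff F k)
    exact ⟨-u, by simpa using hu, by rw [neg_mul, ← hua]⟩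
  have inner : ∀ R ∈ Set.Ioo (0 : ℝ) 1, R ^ k * ‖taylorCoeff F k‖ ≤ 2 * (F 0).re := by
    intro R hR
    have hsub : closedBall (0 : ℂ) R ⊆ unitDisk := closedBall_subset_ball hR.2
    have hFR : DiffContOnCl ℂ F (ball 0 R) :=
      (hF.mono (by rwa [closure_ball _ hR.1.ne'])).diffContOnCl
    have h := re_add_mul_taylorCoeff_nonneg hFR hR.1
      (fun z hz => hre z (hsub (sphere_subset_closedBall hz))) hk hc.le
    have hmul : c * R ^ k / 2 * taylorCoeff F k = ((-(R ^ k * ‖taylorCoeff F k‖ / 2) : ℝ) : ℂ) := by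
      push_cast
      linear_combination (R : ℂ) ^ k / 2 * hca
    rw [hmul, add_re, ofReal_re] at h
    linarith
  have hlim : Tendsto (fun R : ℝ => R ^ k * ‖taylorCoeff F k‖) (𝓝[<] 1) (𝓝 ‖taylorCoeff F k‖) := by
    have : Continuous fun R : ℝ => R ^ k * ‖taylorCoeff F k‖ := by fun_prop
    simpa using (this.tendsto 1).mono_left nhdsWithin_le_nhds
  exact le_of_tendsto hlim (eventually_of_mem (Ioo_mem_nhdsLT zero_lt_one) inner)

theorem norm_taylorCoeff_le_of_norm_le_one (hF : DifferentiableOn ℂ F unitDisk)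
    (hb : ∀ z ∈ unitDisk, ‖F z‖ ≤ 1) (hk : k ≠ 0) : ‖taylorCoeff F k‖ ≤ 2 * (1 - ‖F 0‖) := by
  obtain ⟨u, hu, hu0⟩ := exists_norm_eq_mul_self (F 0)
  have hre : ∀ z ∈ unitDisk, 0 ≤ (1 + -u * F z).re := by
    intro z hz
    have : (u * F z).re ≤ 1 := (re_le_norm _).trans (by simpa [hu] using hb z hz)
    rw [neg_mul, ← sub_eq_add_neg, sub_re, one_re]
    linarith
  have hFa : AnalyticAt ℂ (fun z => -u * F z) 0 :=
    analyticAt_zero_of_differentiableOn (hF.const_mul (-u))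
  have h := norm_taylorCoeff_le_two_mul_re ((hF.const_mul (-u)).const_add 1) hre hk
  rw [taylorCoeff_const_add hFa 1 hk, taylorCoeff_const_mul] at h
  simpa [hu, ← hu0, ← sub_eq_add_neg] using h

/-- The partial sums of the majorant series `∑ |a_k| r ^ k`, constant term included. -/
noncomputable def partialMajorant (F : ℂ → ℂ) (r : ℝ) (N : ℕ) : ℝ :=
  ∑ k ∈ Finset.range N, ‖taylorCoeff F k‖ * r ^ k

theorem partialMajorant_le_one (hF : DifferentiableOn ℂ F unitDisk)
    (hb : ∀ z ∈ unitDisk, ‖F z‖ ≤ 1) {r : ℝ} (h0 : 0 ≤ r) (hr : r ≤ 1 / 3) (N : ℕ) :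
    partialMajorant F r N ≤ 1 := by
  have hF0 : ‖F 0‖ ≤ 1 := hb 0 (mem_ball_self one_pos)
  rcases N with - | N
  · simp [partialMajorant]
  have hgeom : ∑ k ∈ Finset.range N, (1 / 3 : ℝ) ^ (k + 1) ≤ 1 / 2 := by
    simp only [pow_succ, ← Finset.sum_mul]
    rw [geom_sum_eq (by norm_num), div_mul_eq_mul_div, div_le_iff_of_neg (by norm_num)]
    have : (0 : ℝ) ≤ (1 / 3) ^ N := by positivity
    linarith
  calc partialMajorant F r (N + 1)
      = ∑ k ∈ Finset.range N, ‖taylorCoeff F (k + 1)‖ * r ^ (k + 1) + ‖F 0‖ := by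
        rw [partialMajorant, Finset.sum_range_succ', taylorCoeff_zero, pow_zero, mul_one]
    _ ≤ ∑ k ∈ Finset.range N, 2 * (1 - ‖F 0‖) * (1 / 3) ^ (k + 1) + ‖F 0‖ := by
        gcongr with k
        exact norm_taylorCoeff_le_of_norm_le_one hF hb k.succ_ne_zero
    _ ≤ 2 * (1 - ‖F 0‖) * (1 / 2) + ‖F 0‖ := by
        rw [← Finset.mul_sum]
        gcongr
    _ = 1 := by ring

end BohrInequality

section MajorantDomination

variable {F G w : ℂ → ℂ} {r : ℝ}

theorem partialMajorant_congr (h : Set.EqOn F G unitDisk) (r : ℝ) (N : ℕ) :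
    partialMajorant F r N = partialMajorant G r N := by
  rw [partialMajorant, partialMajorant, taylorCoeff_congr h]

theorem partialMajorant_const_add_id_mul (hG : AnalyticAt ℂ G 0) (a : ℂ) (r : ℝ) (N : ℕ) :
    partialMajorant (fun z => a + z * G z) r (N + 1) = ‖a‖ + r * partialMajorant G r N := by
  have hmul : AnalyticAt ℂ (fun z => z * G z) 0 := analyticAt_id.mul hG
  rw [partialMajorant, Finset.sum_range_succ', partialMajorant, Finset.mul_sum, add_comm,
    taylorCoeff_zero, zero_mul, add_zero, pow_zero, mul_one]
  congr 1
  refine Finset.sum_congr rfl fun k _ => ?_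
  rw [taylorCoeff_const_add hmul a k.succ_ne_zero, taylorCoeff_id_mul_succ hG]
  ring

theorem partialMajorant_mul_le (hF : AnalyticAt ℂ F 0) (hG : AnalyticAt ℂ G 0) (h0 : 0 ≤ r)
    (hG1 : ∀ N, partialMajorant G r N ≤ 1) (N : ℕ) :
    partialMajorant (fun z => F z * G z) r N ≤ partialMajorant F r N := by
  let term (H : ℂ → ℂ) (k : ℕ) : ℝ := ‖taylorCoeff H k‖ * r ^ k
  calc partialMajorant (fun z => F z * G z) r N
      ≤ ∑ m ∈ Finset.range N, ∑ k ∈ Finset.range (m + 1), term F k * term G (m - k) := by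
        refine Finset.sum_le_sum fun m _ => ?_
        rw [taylorCoeff_mul hF hG]
        refine (mul_le_mul_of_nonneg_right (norm_sum_le _ _) (pow_nonneg h0 m)).trans_eq ?_
        rw [Finset.sum_mul]
        refine Finset.sum_congr rfl fun k hk => ?_
        rw [norm_mul, mul_mul_mul_comm, ← pow_add,
          Nat.add_sub_cancel' (Nat.lt_succ_iff.1 (Finset.mem_range.1 hk))]
    _ = ∑ k ∈ Finset.range N, term F k * partialMajorant G r (N - k) := by
        rw [Finset.sum_range_diag_flip N fun k j => term F k * term G j]
        simp only [partialMajorant, Finset.mul_sum, term]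
    _ ≤ partialMajorant F r N :=
        Finset.sum_le_sum fun k _ => mul_le_of_le_one_right (by positivity) (hG1 _)

theorem differentiableOn_dslope_zero (hF : DifferentiableOn ℂ F unitDisk) :
    DifferentiableOn ℂ (dslope F 0) unitDisk :=
  (differentiableOn_dslope unitDisk_mem_nhds_zero).2 hF

theorem add_mul_dslope_zero (F : ℂ → ℂ) (z : ℂ) : F 0 + z * dslope F 0 z = F z := by
  have h := sub_smul_dslope F 0 z
  rw [sub_zero, smul_eq_mul] at h
  rw [h, add_sub_cancel]

theorem norm_dslope_zero_le_one (hw : DifferentiableOn ℂ w unitDisk) (hw0 : w 0 = 0)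
    (hm : Set.MapsTo w unitDisk unitDisk) {z : ℂ} (hz : z ∈ unitDisk) : ‖dslope w 0 z‖ ≤ 1 := by
  have hmaps : Set.MapsTo w unitDisk (closedBall (w 0) 1) := fun x hx => by
    rw [hw0]
    exact ball_subset_closedBall (hm hx)
  simpa using norm_dslope_le_div_of_mapsTo_ball hw hmaps hz

/-- Peel off the constant term: `F = F 0 + z F₁` and `w = z ω` give
`F ∘ w = F 0 + z (F₁ ∘ w) ω`, where `ω` is bounded by `1`, so that multiplication by it does not
increase partial majorants. -/
theorem partialMajorant_comp_le (hF : DifferentiableOn ℂ F unitDisk)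
    (hw : DifferentiableOn ℂ w unitDisk) (hw0 : w 0 = 0) (hm : Set.MapsTo w unitDisk unitDisk)
    (h0 : 0 ≤ r) (hr : r ≤ 1 / 3) (N : ℕ) :
    partialMajorant (fun z => F (w z)) r N ≤ partialMajorant F r N := by
  induction N generalizing F with
  | zero => simp [partialMajorant]
  | succ N ih =>
    have hF₁ := differentiableOn_dslope_zero hF
    have hω := differentiableOn_dslope_zero hw
    have hF₁w : DifferentiableOn ℂ (fun z => dslope F 0 (w z)) unitDisk := hF₁.comp hw hm
    have hcomp (z : ℂ) : F (w z) = F 0 + z * (dslope F 0 (w z) * dslope w 0 z) := by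
      rw [← add_mul_dslope_zero F (w z), ← add_mul_dslope_zero w z, hw0]
      ring
    have hω0 := analyticAt_zero_of_differentiableOn hω
    have hF₁w0 := analyticAt_zero_of_differentiableOn hF₁w
    calc partialMajorant (fun z => F (w z)) r (N + 1)
        = ‖F 0‖ + r * partialMajorant (fun z => dslope F 0 (w z) * dslope w 0 z) r N := by
          rw [← partialMajorant_const_add_id_mul (hF₁w0.fun_mul hω0)]
          simp only [hcomp]
      _ ≤ ‖F 0‖ + r * partialMajorant (fun z => dslope F 0 (w z)) r N := by
          gcongr
          refine partialMajorant_mul_le hF₁w0 hω0 h0 ?_ N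
          exact partialMajorant_le_one hω (fun z => norm_dslope_zero_le_one hw hw0 hm) h0 hr
      _ ≤ ‖F 0‖ + r * partialMajorant (dslope F 0) r N := by
          gcongr
          exact ih hF₁
      _ = partialMajorant F r (N + 1) := by
          rw [← partialMajorant_const_add_id_mul (analyticAt_zero_of_differentiableOn hF₁)]
          simp only [add_mul_dslope_zero]

theorem tendsto_partialMajorant (hF : DifferentiableOn ℂ F unitDisk) (hF0 : F 0 = 0) (h0 : 0 ≤ r)
    (h1 : r < 1) : Tendsto (fun N => partialMajorant F r N) atTop (𝓝 (majorant F r)) := by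
  have hs := summable_norm_taylorCoeff hF h0 h1
  have hmaj : majorant F r = ∑' k, ‖taylorCoeff F k‖ * r ^ k := by
    rw [hs.tsum_eq_zero_add, taylorCoeff_zero, hF0, norm_zero, zero_mul, zero_add, majorant]
  rw [hmaj]
  exact hs.hasSum.tendsto_sum_nat

theorem majorant_le_of_subordinate (hF : DifferentiableOn ℂ F unitDisk) (hF0 : F 0 = 0)
    (hG : DifferentiableOn ℂ G unitDisk) (hGF : Subordinate G F) (h0 : 0 ≤ r) (hr : r ≤ 1 / 3) :
    majorant G r ≤ majorant F r := by
  obtain ⟨w, hw, hw0, hm, hcomp⟩ := hGF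
  have hG0 : G 0 = 0 := by rw [hcomp 0 (mem_ball_self one_pos), hw0, hF0]
  refine le_of_tendsto_of_tendsto' (tendsto_partialMajorant hG hG0 h0 (by linarith))
    (tendsto_partialMajorant hF hF0 h0 (by linarith)) fun N => ?_
  rw [partialMajorant_congr hcomp]
  exact partialMajorant_comp_le hF hw hw0 hm h0 hr N

theorem majorant_id_mul_le_of_subordinate (hF : DifferentiableOn ℂ F unitDisk)
    (hG : DifferentiableOn ℂ G unitDisk) (hGF : Subordinate G F) (h0 : 0 ≤ r) (hr : r ≤ 1 / 3) :
    majorant (fun z => z * G z) r ≤ majorant (fun z => z * F z) r := by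
  obtain ⟨w, hw, hw0, hm, hcomp⟩ := hGF
  have tendsto {H : ℂ → ℂ} (hH : DifferentiableOn ℂ H unitDisk) :
      Tendsto (fun N => r * partialMajorant H r N) atTop (𝓝 (majorant (fun z => z * H z) r)) := by
    have hzH : DifferentiableOn ℂ (fun z => z * H z) unitDisk := differentiableOn_id.mul hH
    have h := (tendsto_add_atTop_iff_nat 1).2
      (tendsto_partialMajorant hzH (zero_mul (H 0)) h0 (by linarith))
    have hmul := partialMajorant_const_add_id_mul (analyticAt_zero_of_differentiableOn hH) 0 r
    simp only [zero_add, norm_zero] at hmul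
    simpa only [hmul] using h
  refine le_of_tendsto_of_tendsto' (tendsto hG) (tendsto hF) fun N => ?_
  rw [partialMajorant_congr hcomp]
  exact mul_le_mul_of_nonneg_left (partialMajorant_comp_le hF hw hw0 hm h0 hr N) h0

end MajorantDomination

section JackLemma

theorem re_nonneg_and_im_eq_zero_of_isMaxOn_norm {f : ℂ → ℂ} {d : ℂ} (hd : HasDerivAt f d 0)
    (hf0 : f 0 = 1) (hmax : ∀ ζ : ℂ, ζ.re ≤ 0 → ‖f ζ‖ ≤ 1) : 0 ≤ d.re ∧ d.im = 0 := by
  have directional : ∀ ζ : ℂ, ζ.re ≤ 0 → (d * ζ).re ≤ 0 := by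
    intro ζ hζ
    have hderiv := (reCLM.hasFDerivAt.comp 0 (hd.hasFDerivAt.restrictScalars ℝ)).hasFDerivWithinAt
      (s := {ζ : ℂ | ζ.re ≤ 0})
    have hlocal : IsLocalMaxOn (reCLM ∘ f) {ζ : ℂ | ζ.re ≤ 0} 0 := by
      refine IsMaxOn.localize fun ξ hξ => ?_
      simpa [hf0] using (re_le_norm (f ξ)).trans (hmax ξ hξ)
    have htangent : ζ ∈ posTangentConeAt {ζ : ℂ | ζ.re ≤ 0} 0 := by
      refine mem_posTangentConeAt_of_segment_subset ?_
      refine (convex_halfSpace_re_le 0).segment_subset (by simp) (by simpa using hζ)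
    simpa [mul_comm] using hlocal.hasFDerivWithinAt_nonpos hderiv htangent
  have h1 := directional (-1) (by simp)
  have hI := directional I (by simp)
  have hI' := directional (-I) (by simp)
  simp only [mul_neg, mul_one, neg_re, mul_I_re, neg_neg] at h1 hI hI'
  exact ⟨by linarith, by linarith⟩

theorem norm_le_norm_div_mul_norm {v : ℂ → ℂ} {z₀ : ℂ} (hv : DifferentiableOn ℂ v (ball 0 ‖z₀‖))
    (hv0 : v 0 = 0) (hmax : ∀ z, ‖z‖ ≤ ‖z₀‖ → ‖v z‖ ≤ ‖v z₀‖) (hz₀ : z₀ ≠ 0) {z : ℂ}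
    (hz : ‖z‖ ≤ ‖z₀‖) : ‖v z‖ ≤ ‖z‖ / ‖z₀‖ * ‖v z₀‖ := by
  rcases hz.lt_or_eq with hlt | heq
  · have hmaps : Set.MapsTo v (ball 0 ‖z₀‖) (closedBall (v 0) ‖v z₀‖) := fun y hy => by
      simpa [hv0] using hmax y (mem_ball_zero_iff.1 hy).le
    have h := dist_le_div_mul_dist_of_mapsTo_ball hv hmaps (mem_ball_zero_iff.2 hlt)
    rw [hv0, dist_zero_right, dist_zero_right] at h
    rwa [div_mul_comm]
  · rw [heq, div_self (norm_ne_zero_iff.2 hz₀), one_mul]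
    exact hmax z hz

/-- Jack's lemma. The Schwarz quotient `v (z₀ e ^ ζ) / (v z₀ e ^ ζ)` is bounded by `1` on the
left half-plane and equals `1` at the boundary point `0`. -/
theorem exists_one_le_mul_deriv_eq_mul {v : ℂ → ℂ} {z₀ : ℂ}
    (hv : DifferentiableOn ℂ v (ball 0 ‖z₀‖)) (hvz₀ : DifferentiableAt ℂ v z₀) (hv0 : v 0 = 0)
    (hmax : ∀ z, ‖z‖ ≤ ‖z₀‖ → ‖v z‖ ≤ ‖v z₀‖) (hne : v z₀ ≠ 0) :
    ∃ m : ℝ, 1 ≤ m ∧ z₀ * deriv v z₀ = m * v z₀ := by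
  have hz₀ : z₀ ≠ 0 := by
    rintro rfl
    exact hne hv0
  let quotient (ζ : ℂ) : ℂ := v (z₀ * exp ζ) * exp (-ζ) / v z₀
  have hderiv : HasDerivAt quotient (z₀ * deriv v z₀ / v z₀ - 1) 0 := by
    have hpath : HasDerivAt (fun ζ : ℂ => z₀ * exp ζ) z₀ 0 := by
      simpa using (hasDerivAt_exp 0).const_mul z₀
    have hv' : HasDerivAt v (deriv v z₀) (z₀ * exp 0) := by simpa using hvz₀.hasDerivAt
    have h := ((hv'.comp 0 hpath).mul (hasDerivAt_neg (0 : ℂ)).cexp).div_const (v z₀)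
    refine h.congr_deriv ?_
    simp only [Function.comp_apply, exp_zero, neg_zero, mul_one]
    field_simp
    ring
  have hbound : ∀ ζ : ℂ, ζ.re ≤ 0 → ‖quotient ζ‖ ≤ 1 := by
    intro ζ hζ
    have hnorm : ‖z₀ * exp ζ‖ = ‖z₀‖ * Real.exp ζ.re := by rw [norm_mul, norm_exp]
    have hle : ‖z₀ * exp ζ‖ ≤ ‖z₀‖ := by
      rw [hnorm]
      exact mul_le_of_le_one_right (norm_nonneg _) (Real.exp_le_one_iff.2 hζ)
    have h := norm_le_norm_div_mul_norm hv hv0 hmax hz₀ hle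
    rw [hnorm, mul_div_cancel_left₀ _ (norm_ne_zero_iff.2 hz₀)] at h
    rw [norm_div, norm_mul, norm_exp, neg_re, Real.exp_neg,
      div_le_one (norm_pos_iff.2 hne), ← div_eq_mul_inv, div_le_iff₀' (Real.exp_pos _)]
    exact h
  obtain ⟨hre, him⟩ := re_nonneg_and_im_eq_zero_of_isMaxOn_norm hderiv
    (by simp [quotient, hne]) hbound
  set m := z₀ * deriv v z₀ / v z₀ with hm
  refine ⟨m.re, by simpa using hre, ?_⟩
  have hreal : (m.re : ℂ) = m := Complex.ext rfl (by simpa using him.symm)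
  rw [hreal, hm, div_mul_cancel₀ _ hne]

theorem exists_norm_eq_one_of_not_mapsTo {v : ℂ → ℂ} (hv : ContinuousOn v unitDisk)
    (hv0 : v 0 = 0) (hnot : ¬Set.MapsTo v unitDisk unitDisk) :
    ∃ z₀ ∈ unitDisk, ‖v z₀‖ = 1 ∧ ∀ z, ‖z‖ ≤ ‖z₀‖ → ‖v z‖ ≤ 1 := by
  obtain ⟨z₁, hz₁, hv₁⟩ : ∃ z₁ ∈ unitDisk, 1 ≤ ‖v z₁‖ := by
    simpa [Set.MapsTo] using hnot
  have hball : closedBall (0 : ℂ) ‖z₁‖ ⊆ unitDisk :=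
    closedBall_subset_ball (mem_ball_zero_iff.1 hz₁)
  have hcompact : IsCompact (closedBall (0 : ℂ) ‖z₁‖ ∩ (fun z => ‖v z‖) ⁻¹' Set.Ici 1) :=
    (isCompact_closedBall (0 : ℂ) ‖z₁‖).of_isClosed_subset
      ((hv.mono hball).norm.preimage_isClosed_of_isClosed isClosed_closedBall isClosed_Ici)
      Set.inter_subset_left
  obtain ⟨z₀, ⟨hz₀, hge⟩, hmin⟩ :=
    hcompact.exists_isMinOn ⟨z₁, by simp, hv₁⟩ continuous_norm.continuousOn
  have hge : 1 ≤ ‖v z₀‖ := hge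
  have hz₀D : z₀ ∈ unitDisk := hball hz₀
  have hlt : Set.MapsTo v (ball 0 ‖z₀‖) (closedBall 0 1) := by
    intro z hz
    rw [mem_ball_zero_iff] at hz
    rw [mem_closedBall_zero_iff] at hz₀ ⊢
    by_contra! h
    exact hz.not_ge (hmin ⟨mem_closedBall_zero_iff.2 (hz.le.trans hz₀), h.le⟩)
  have hz₀0 : ‖z₀‖ ≠ 0 := by
    rw [norm_ne_zero_iff]
    rintro rfl
    norm_num [hv0] at hge
  have hle : Set.MapsTo v (closedBall 0 ‖z₀‖) (closedBall 0 1) := by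
    have hcont : ContinuousOn v (closure (ball 0 ‖z₀‖)) := by
      rw [closure_ball _ hz₀0]
      exact hv.mono (closedBall_subset_ball (mem_ball_zero_iff.1 hz₀D))
    have h := hlt.closure_of_continuousOn hcont
    rwa [closure_ball _ hz₀0, isClosed_closedBall.closure_eq] at h
  have hle' : ∀ z, ‖z‖ ≤ ‖z₀‖ → ‖v z‖ ≤ 1 := fun z hz => by
    simpa using hle (mem_closedBall_zero_iff.2 hz)
  exact ⟨z₀, hz₀D, (hle' z₀ le_rfl).antisymm hge, hle'⟩

end JackLemma

section LogarithmicDerivative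

theorem exists_eq_exp_of_ne_zero {q : ℂ → ℂ} (hq : DifferentiableOn ℂ q unitDisk)
    (hne : ∀ z ∈ unitDisk, q z ≠ 0) (hq0 : q 0 = 1) :
    ∃ ℓ : ℂ → ℂ, DifferentiableOn ℂ ℓ unitDisk ∧ ℓ 0 = 0 ∧ ∀ z ∈ unitDisk, q z = exp (ℓ z) := by
  obtain ⟨ℓ, hℓ0, hℓ⟩ :=
    ((hq.deriv isOpen_ball).div hq hne).isExactOn_ball.with_val_at (0 : ℂ) 0
  have hdiff : DifferentiableOn ℂ ℓ unitDisk := fun z hz =>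
    (hℓ z hz).differentiableAt.differentiableWithinAt
  refine ⟨ℓ, hdiff, hℓ0, fun z hz => ?_⟩
  have hderiv : ∀ y ∈ unitDisk, HasDerivAt (fun y => q y * exp (-ℓ y)) 0 y := by
    intro y hy
    have h := (hq.differentiableAt (isOpen_ball.mem_nhds hy)).hasDerivAt.fun_mul (hℓ y hy).neg.cexp
    refine h.congr_deriv ?_
    have hqy := hne y hy
    simp only [Pi.neg_apply, Pi.div_apply]
    field_simp
    ring
  have hconst := isOpen_ball.is_const_of_deriv_eq_zero (convex_ball (0 : ℂ) 1).isPreconnected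
    (fun y hy => (hderiv y hy).differentiableAt.differentiableWithinAt)
    (fun y hy => (hderiv y hy).deriv) hz (mem_ball_self one_pos)
  simp only [hℓ0, hq0, neg_zero, exp_zero, mul_one] at hconst
  rwa [exp_neg, mul_inv_eq_one₀ (exp_ne_zero _)] at hconst

theorem exists_eq_id_mul_exp {f : ℂ → ℂ} (hf : f ∈ classA)
    (hne : ∀ z ∈ unitDisk, z ≠ 0 → f z ≠ 0) :
    ∃ ℓ : ℂ → ℂ, DifferentiableOn ℂ ℓ unitDisk ∧ ℓ 0 = 0 ∧
      ∀ z ∈ unitDisk, f z = z * exp (ℓ z) := by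
  obtain ⟨hdiff, hf0, hf1⟩ := hf
  have hmul : ∀ z, z * dslope f 0 z = f z := fun z => by
    simpa [hf0] using add_mul_dslope_zero f z
  have hone : dslope f 0 0 = 1 := by rw [dslope_same, hf1]
  have hdslope : ∀ z ∈ unitDisk, dslope f 0 z ≠ 0 := by
    intro z hz
    rcases eq_or_ne z 0 with rfl | hz0
    · exact hone ▸ one_ne_zero
    · exact right_ne_zero_of_mul (hmul z ▸ hne z hz hz0)
  obtain ⟨ℓ, hℓ, hℓ0, hexp⟩ :=
    exists_eq_exp_of_ne_zero (differentiableOn_dslope_zero hdiff) hdslope hone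
  exact ⟨ℓ, hℓ, hℓ0, fun z hz => by rw [← hexp z hz, hmul]⟩

theorem logDerivQuotient_eq_of_eq_id_mul_exp {f ℓ : ℂ → ℂ} (hℓ : DifferentiableOn ℂ ℓ unitDisk)
    (hf : ∀ z ∈ unitDisk, f z = z * exp (ℓ z)) {z : ℂ} (hz : z ∈ unitDisk) :
    logDerivQuotient f z = 1 + z * deriv ℓ z := by
  rw [logDerivQuotient]
  split_ifs with hz0
  · simp [hz0]
  · have hderiv : HasDerivAt f (1 * exp (ℓ z) + z * (exp (ℓ z) * deriv ℓ z)) z :=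
      ((hasDerivAt_id z).fun_mul
        (hℓ.differentiableAt (isOpen_ball.mem_nhds hz)).hasDerivAt.cexp).congr_of_eventuallyEq
        (eventually_of_mem (isOpen_ball.mem_nhds hz) hf)
    rw [hderiv.deriv, hf z hz]
    have := exp_ne_zero (ℓ z)
    field_simp

end LogarithmicDerivative

section Univalence

/-- Noshiro–Warschawski. -/
theorem injOn_of_convex_of_re_deriv_pos {s : Set ℂ} (hs : Convex ℝ s) {F F' : ℂ → ℂ}
    (hF : ∀ u ∈ s, HasDerivAt F (F' u) u) (hpos : ∀ u ∈ s, 0 < (F' u).re) : Set.InjOn F s := by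
  intro a ha b hb hab
  by_contra hne
  have hseg : ∀ t ∈ Set.Icc (0 : ℝ) 1, a + t * (b - a) ∈ s := fun t ht => by
    simpa using hs.add_smul_sub_mem ha hb ht
  let φ (t : ℝ) : ℝ := (F (a + t * (b - a)) / (b - a)).re
  have hφ : ∀ t ∈ Set.Icc (0 : ℝ) 1, HasDerivAt φ (F' (a + t * (b - a))).re t := by
    intro t ht
    have hline : HasDerivAt (fun t : ℂ => a + t * (b - a)) (b - a) (t : ℂ) := by
      simpa using ((hasDerivAt_id (t : ℂ)).mul_const (b - a)).const_add a
    have h := (((hF _ (hseg t ht)).comp (t : ℂ) hline).div_const (b - a)).real_of_complex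
    rwa [mul_div_cancel_right₀ _ (sub_ne_zero.2 (Ne.symm hne))] at h
  obtain ⟨t, ht, hslope⟩ := exists_hasDerivAt_eq_slope φ (fun t => (F' (a + t * (b - a))).re)
    one_pos (fun t ht => (hφ t ht).continuousAt.continuousWithinAt)
    fun t ht => hφ t (Set.Ioo_subset_Icc_self ht)
  have hzero : φ 1 - φ 0 = 0 := by simp [φ, hab]
  rw [hzero, zero_div] at hslope
  exact (hpos _ (hseg t (Set.Ioo_subset_Icc_self ht))).ne' hslope

/-- The function `F u = log (f (e ^ u)) = u + ℓ (e ^ u)` has derivative of positive real part on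
the left half-plane, and `F (u + 2 π i n) = F u + 2 π i n`. -/
theorem injOn_of_re_logDerivQuotient_pos {f : ℂ → ℂ} (hf : f ∈ classA)
    (hne : ∀ z ∈ unitDisk, z ≠ 0 → f z ≠ 0)
    (hre : ∀ z ∈ unitDisk, 0 < (logDerivQuotient f z).re) : Set.InjOn f unitDisk := by
  obtain ⟨ℓ, hℓ, -, hfℓ⟩ := exists_eq_id_mul_exp hf hne
  let F (u : ℂ) : ℂ := u + ℓ (exp u)
  have hdisk : ∀ u : ℂ, u.re < 0 → exp u ∈ unitDisk := fun u hu => by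
    simpa [norm_exp] using hu
  have hinj : Set.InjOn F {u : ℂ | u.re < 0} := by
    refine injOn_of_convex_of_re_deriv_pos (F' := fun u => logDerivQuotient f (exp u))
      (convex_halfSpace_re_lt 0) (fun u hu => ?_) fun u hu => hre _ (hdisk u hu)
    rw [logDerivQuotient_eq_of_eq_id_mul_exp hℓ hfℓ (hdisk u hu), mul_comm]
    exact (hasDerivAt_id u).add ((hℓ.differentiableAt
      (isOpen_ball.mem_nhds (hdisk u hu))).hasDerivAt.comp u (hasDerivAt_exp u))
  have hexpF : ∀ u : ℂ, u.re < 0 → f (exp u) = exp (F u) := fun u hu => by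
    rw [hfℓ _ (hdisk u hu), exp_add]
  have hlog : ∀ z ∈ unitDisk, z ≠ 0 → ∃ u : ℂ, u.re < 0 ∧ exp u = z := fun z hz hz0 => by
    refine ⟨log z, ?_, exp_log hz0⟩
    rw [log_re]
    exact Real.log_neg (norm_pos_iff.2 hz0) (mem_ball_zero_iff.1 hz)
  intro z₁ hz₁ z₂ hz₂ h
  rcases eq_or_ne z₁ 0 with rfl | hz₁0
  · by_contra hz₂0
    exact hne z₂ hz₂ (Ne.symm hz₂0) (h ▸ hf.2.1)
  rcases eq_or_ne z₂ 0 with rfl | hz₂0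
  · exact absurd (h.trans hf.2.1) (hne z₁ hz₁ hz₁0)
  obtain ⟨u₁, hu₁, rfl⟩ := hlog z₁ hz₁ hz₁0
  obtain ⟨u₂, hu₂, rfl⟩ := hlog z₂ hz₂ hz₂0
  rw [hexpF u₁ hu₁, hexpF u₂ hu₂, exp_eq_exp_iff_exists_int] at h
  obtain ⟨n, hn⟩ := h
  refine exp_eq_exp_iff_exists_int.2 ⟨n, hinj hu₁ (by simpa using hu₂) ?_⟩
  simp only [F] at hn ⊢
  rw [hn, (exp_eq_exp_iff_exists_int (x := u₂ + n * (2 * Real.pi * I)) (y := u₂)).2 ⟨n, rfl⟩]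
  ring

theorem deriv_ne_zero_of_re_logDerivQuotient_pos {f : ℂ → ℂ} (hf : f ∈ classA) {z : ℂ}
    (hre : 0 < (logDerivQuotient f z).re) : deriv f z ≠ 0 := by
  intro h
  rw [logDerivQuotient] at hre
  split_ifs at hre with hz0
  · rw [hz0, hf.2.2] at h
    exact one_ne_zero h
  · simp [h] at hre

end Univalence

section ImageOfDisk

variable {f : ℂ → ℂ}

theorem image_mem_nhds_of_deriv_ne_zero (hf : DifferentiableOn ℂ f unitDisk) {a : ℂ}
    (ha : a ∈ unitDisk) (hd : deriv f a ≠ 0) {U : Set ℂ} (hU : U ∈ 𝓝 a) : f '' U ∈ 𝓝 (f a) := by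
  rw [← (hf.analyticAt (isOpen_ball.mem_nhds ha)).hasStrictDerivAt.map_nhds_eq hd]
  exact image_mem_map hU

theorem isOpen_image_unitDisk (hf : DifferentiableOn ℂ f unitDisk)
    (hd : ∀ z ∈ unitDisk, deriv f z ≠ 0) : IsOpen (f '' unitDisk) := by
  rw [isOpen_iff_mem_nhds]
  rintro _ ⟨a, ha, rfl⟩
  exact image_mem_nhds_of_deriv_ne_zero hf ha (hd a ha) (isOpen_ball.mem_nhds ha)

/-- Otherwise the inverse would be a bounded entire function. -/
theorem image_unitDisk_ne_univ (hf : DifferentiableOn ℂ f unitDisk)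
    (hd : ∀ z ∈ unitDisk, deriv f z ≠ 0) (hinj : Set.InjOn f unitDisk) :
    f '' unitDisk ≠ Set.univ := by
  intro huniv
  have hsurj : ∀ y, ∃ z ∈ unitDisk, f z = y := fun y => huniv.ge (Set.mem_univ y)
  choose inverse hmem hright using hsurj
  have hcont : ∀ y, ContinuousAt inverse y := by
    refine fun y => tendsto_def.2 fun U hU => ?_
    have himage := image_mem_nhds_of_deriv_ne_zero hf (hmem y) (hd _ (hmem y))
      (inter_mem hU (isOpen_ball.mem_nhds (hmem y)))
    rw [hright] at himage
    filter_upwards [himage]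
    rintro _ ⟨z, ⟨hzU, hz⟩, rfl⟩
    rwa [Set.mem_preimage, hinj (hmem _) hz (hright _)]
  have hentire : Differentiable ℂ inverse := fun y =>
    ((hf.differentiableAt (isOpen_ball.mem_nhds (hmem y))).hasDerivAt.of_local_left_inverse
      (hcont y) (hd _ (hmem y)) (.of_forall hright)).differentiableAt
  have hbounded : Bornology.IsBounded (Set.range inverse) :=
    isBounded_ball.subset (Set.range_subset_iff.2 hmem)
  have hconst := congrArg f (hentire.apply_eq_apply_of_bounded hbounded 0 1)
  rw [hright, hright] at hconst
  exact zero_ne_one hconst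

theorem le_boundaryDist (hf : DifferentiableOn ℂ f unitDisk) (hf0 : f 0 = 0)
    (hopen : IsOpen (f '' unitDisk)) (huniv : f '' unitDisk ≠ Set.univ) {δ : ℝ} (hδ : 0 < δ)
    (h : ∀ z ∈ unitDisk, ‖z‖ * δ ≤ ‖f z‖) : δ ≤ boundaryDist f := by
  have hne : (frontier (f '' unitDisk)).Nonempty := by
    rw [nonempty_frontier_iff]
    exact ⟨⟨f 0, 0, by simp, rfl⟩, huniv⟩
  rw [boundaryDist, hf0, le_infDist hne]
  intro y hy
  rw [hopen.frontier_eq] at hy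
  rw [dist_zero_left]
  by_contra! hlt
  obtain ⟨ρ, hyρ, hρ⟩ := exists_between ((div_lt_one hδ).2 hlt)
  rw [div_lt_iff₀ hδ] at hyρ
  have hball : closedBall (0 : ℂ) ρ ⊆ unitDisk := closedBall_subset_ball hρ
  have hclosed : IsClosed (f '' closedBall 0 ρ) :=
    ((isCompact_closedBall (0 : ℂ) ρ).image_of_continuousOn (hf.mono hball).continuousOn).isClosed
  have hclosure : y ∈ closure (f '' unitDisk ∩ ball 0 (ρ * δ)) :=
    isOpen_ball.closure_inter ⟨hy.1, mem_ball_zero_iff.2 hyρ⟩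
  have hsub : f '' unitDisk ∩ ball 0 (ρ * δ) ⊆ f '' closedBall 0 ρ := by
    rintro _ ⟨⟨z, hz, rfl⟩, hfz⟩
    refine ⟨z, mem_closedBall_zero_iff.2 ?_, rfl⟩
    exact (lt_of_mul_lt_mul_right ((h z hz).trans_lt (mem_ball_zero_iff.1 hfz)) hδ.le).le
  exact hy.2 (Set.image_mono hball (closure_minimal hsub hclosed hclosure))

theorem mem_frontier_of_tendsto (hf : DifferentiableOn ℂ f unitDisk)
    (hd : ∀ z ∈ unitDisk, deriv f z ≠ 0) (hinj : Set.InjOn f unitDisk) {ι : Type*} {l : Filter ι}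
    [l.NeBot] {u : ι → ℂ} (hu : ∀ᶠ i in l, u i ∈ unitDisk) (hnorm : Tendsto (‖u ·‖) l (𝓝 1))
    {y : ℂ} (hy : Tendsto (fun i => f (u i)) l (𝓝 y)) : y ∈ frontier (f '' unitDisk) := by
  rw [(isOpen_image_unitDisk hf hd).frontier_eq]
  refine ⟨mem_closure_of_tendsto hy (hu.mono fun i hi => ⟨_, hi, rfl⟩), ?_⟩
  rintro ⟨a, ha, rfl⟩
  obtain ⟨s, has, hs⟩ := exists_between (mem_ball_zero_iff.1 ha)
  have hU := image_mem_nhds_of_deriv_ne_zero hf ha (hd a ha)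
    (isOpen_ball.mem_nhds (mem_ball_zero_iff.2 has))
  obtain ⟨i, ⟨z, hz, hzi⟩, hui, hsi⟩ :=
    ((hy.eventually hU).and (hu.and (hnorm.eventually (lt_mem_nhds hs)))).exists
  rw [hinj (ball_subset_ball hs.le hz) hui hzi, mem_ball_zero_iff] at hz
  exact hz.not_gt hsi

end ImageOfDisk

section StarlikeClass

variable {ψ f : ℂ → ℂ}

theorem re_logDerivQuotient_pos_of_mem_starlikeClass (hψ : ∀ w ∈ unitDisk, 0 < (ψ w).re)
    (hf : f ∈ starlikeClass ψ) {z : ℂ} (hz : z ∈ unitDisk) : 0 < (logDerivQuotient f z).re := by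
  obtain ⟨-, -, w, -, -, hm, hw⟩ := hf
  rw [hw z hz]
  exact hψ _ (hm z hz)

theorem injOn_of_mem_starlikeClass (hψ : ∀ w ∈ unitDisk, 0 < (ψ w).re)
    (hf : f ∈ starlikeClass ψ) : Set.InjOn f unitDisk :=
  injOn_of_re_logDerivQuotient_pos hf.1 hf.2.1 fun _ hz =>
    re_logDerivQuotient_pos_of_mem_starlikeClass hψ hf hz

theorem deriv_ne_zero_of_mem_starlikeClass (hψ : ∀ w ∈ unitDisk, 0 < (ψ w).re)
    (hf : f ∈ starlikeClass ψ) {z : ℂ} (hz : z ∈ unitDisk) : deriv f z ≠ 0 :=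
  deriv_ne_zero_of_re_logDerivQuotient_pos hf.1
    (re_logDerivQuotient_pos_of_mem_starlikeClass hψ hf hz)

theorem le_boundaryDist_of_mem_starlikeClass (hψ : ∀ w ∈ unitDisk, 0 < (ψ w).re)
    (hf : f ∈ starlikeClass ψ) {δ : ℝ} (hδ : 0 < δ) (h : ∀ z ∈ unitDisk, ‖z‖ * δ ≤ ‖f z‖) :
    δ ≤ boundaryDist f := by
  have hd : ∀ z ∈ unitDisk, deriv f z ≠ 0 := fun _ hz =>
    deriv_ne_zero_of_mem_starlikeClass hψ hf hz
  exact le_boundaryDist hf.1.1 hf.1.2.1 (isOpen_image_unitDisk hf.1.1 hd)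
    (image_unitDisk_ne_univ hf.1.1 hd (injOn_of_mem_starlikeClass hψ hf)) hδ h

theorem mem_subordinants_self (hf : DifferentiableOn ℂ f unitDisk) : f ∈ subordinants f :=
  ⟨hf, id, differentiableOn_id, rfl, fun _ hz => hz, fun _ _ => rfl⟩

end StarlikeClass

section SchwarzFunction

variable {c : ℂ}

theorem re_one_add_mul_pos (hc : ‖c‖ ≤ 1) {z : ℂ} (hz : z ∈ unitDisk) : 0 < (1 + c * z).re := by
  have hlt : ‖c * z‖ < 1 := by
    rw [norm_mul]
    exact mul_lt_one_of_nonneg_of_lt_one_right hc (norm_nonneg z) (mem_ball_zero_iff.1 hz)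
  rw [add_re, one_re]
  linarith [(abs_lt.1 ((abs_re_le_norm (c * z)).trans_lt hlt)).1]

theorem one_add_mul_ne_zero (hc : ‖c‖ ≤ 1) {z : ℂ} (hz : z ∈ unitDisk) : 1 + c * z ≠ 0 := by
  intro h
  simpa [h] using re_one_add_mul_pos hc hz

theorem exists_hasDerivAt_one_add_mul_mul_deriv {Λ : ℂ → ℂ} (hΛ : DifferentiableOn ℂ Λ unitDisk)
    (hΛ0 : Λ 0 = 0) (c : ℂ) : ∃ v : ℂ → ℂ, v 0 = 0 ∧
      ∀ z ∈ unitDisk, HasDerivAt v ((1 + c * v z) * deriv Λ z) z := by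
  have hderiv : ∀ z ∈ unitDisk, HasDerivAt Λ (deriv Λ z) z := fun z hz =>
    (hΛ.differentiableAt (isOpen_ball.mem_nhds hz)).hasDerivAt
  rcases eq_or_ne c 0 with rfl | hc
  · exact ⟨Λ, hΛ0, fun z hz => by simpa using hderiv z hz⟩
  · refine ⟨fun z => (exp (c * Λ z) - 1) / c, by simp [hΛ0], fun z hz => ?_⟩
    refine ((((hderiv z hz).const_mul c).cexp.sub_const 1).div_const c).congr_deriv ?_
    field_simp
    ring

/-- At a first point where `‖v z₀‖ = 1`, Jack's lemma turns the equation into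
`m v = w (1 - (m - 1) c v)` with `m ≥ 1`, whose right-hand side has norm less than `m`. -/
theorem mapsTo_unitDisk_of_mul_deriv_eq (hc : ‖c‖ ≤ 1) {v w : ℂ → ℂ}
    (hv : DifferentiableOn ℂ v unitDisk) (hv0 : v 0 = 0) (hw : Set.MapsTo w unitDisk unitDisk)
    (hode : ∀ z ∈ unitDisk, z * deriv v z * (1 + c * w z) = (1 + c * v z) * w z) :
    Set.MapsTo v unitDisk unitDisk := by
  by_contra hnot
  obtain ⟨z₀, hz₀, hnorm, hmax⟩ := exists_norm_eq_one_of_not_mapsTo hv.continuousOn hv0 hnot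
  obtain ⟨m, hm, hjack⟩ := exists_one_le_mul_deriv_eq_mul
    (hv.mono (ball_subset_ball (mem_ball_zero_iff.1 hz₀).le))
    (hv.differentiableAt (isOpen_ball.mem_nhds hz₀)) hv0 (by rwa [hnorm])
    (norm_ne_zero_iff.1 (hnorm ▸ one_ne_zero))
  have hwlt : ‖w z₀‖ < 1 := mem_ball_zero_iff.1 (hw hz₀)
  have heq : m * v z₀ = w z₀ * (1 - (m - 1 : ℝ) * c * v z₀) := by
    have h := hode z₀ hz₀
    rw [hjack] at h
    push_cast
    linear_combination h
  have hright : ‖1 - (m - 1 : ℝ) * c * v z₀‖ ≤ m := by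
    refine (norm_sub_le _ _).trans ?_
    rw [norm_one, norm_mul, norm_mul, hnorm, norm_real, Real.norm_of_nonneg (by linarith), mul_one]
    nlinarith
  have hnormeq := congrArg norm heq
  rw [norm_mul, norm_mul, hnorm, norm_real, Real.norm_of_nonneg (by linarith), mul_one] at hnormeq
  nlinarith [norm_nonneg (w z₀)]

end SchwarzFunction

section JanowskiFunction

theorem one_add_mul_div_one_add_mul {K : Type*} [Field K] {a b x : K} (h : 1 + b * x ≠ 0) :
    (1 + a * x) / (1 + b * x) = 1 + x * ((a - b) / (1 + b * x)) := by
  rw [div_eq_iff h, add_mul, mul_assoc, div_mul_cancel₀ _ h]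
  ring

variable {D E : ℝ}

theorem janowskiPsi_eq_one_add (hE : |E| ≤ 1) {z : ℂ} (hz : z ∈ unitDisk) :
    janowskiPsi D E z = 1 + z * ((D - E) / (1 + E * z)) := by
  rw [janowskiPsi, one_add_mul_div_one_add_mul]
  exact one_add_mul_ne_zero ((norm_real E).trans_le hE) hz

theorem re_janowskiPsi_pos (hE : |E| ≤ 1) (hD : |D| ≤ 1) {w : ℂ} (hw : w ∈ unitDisk) :
    0 < (janowskiPsi D E w).re := by
  have hsq : w.re * w.re + w.im * w.im = ‖w‖ ^ 2 := by rw [← normSq_apply, normSq_eq_norm_sq]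
  have hw1 : ‖w‖ < 1 := mem_ball_zero_iff.1 hw
  obtain ⟨hre₁, hre₂⟩ := abs_le.1 (abs_re_le_norm w)
  obtain ⟨hE₁, hE₂⟩ := abs_le.1 hE
  obtain ⟨hD₁, hD₂⟩ := abs_le.1 hD
  have hpos : 0 < 1 + (D + E) * w.re + D * E * ‖w‖ ^ 2 := by
    have factor_pos : ∀ c : ℝ, c ≤ 1 → 0 < 1 - c * ‖w‖ := fun c hc => by
      nlinarith [norm_nonneg w]
    rcases le_total 0 (D + E) with h | h
    · nlinarith [mul_pos (factor_pos D hD₂) (factor_pos E hE₂)]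
    · nlinarith [mul_pos (factor_pos (-D) (by linarith)) (factor_pos (-E) (by linarith))]
  rw [janowskiPsi, div_re, ← add_div]
  refine div_pos ?_ (normSq_pos.2 (one_add_mul_ne_zero ((norm_real E).trans_le hE) hw))
  simp only [add_re, one_re, mul_re, ofReal_re, ofReal_im, zero_mul, sub_zero, add_im, one_im,
    mul_im, add_zero, zero_add]
  linear_combination hpos - D * E * hsq

open Classical in
/-- The logarithm of `f₀(z) / z`. -/
noncomputable def extremalLog (D E : ℝ) (z : ℂ) : ℂ :=
  if E = 0 then D * z else ((D - E) / E : ℝ) * log (1 + E * z)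

theorem extremalLog_zero (D E : ℝ) : extremalLog D E 0 = 0 := by
  simp [extremalLog]

theorem hasDerivAt_extremalLog (hE : |E| ≤ 1) {z : ℂ} (hz : z ∈ unitDisk) :
    HasDerivAt (extremalLog D E) ((D - E) / (1 + E * z)) z := by
  unfold extremalLog
  have hE' : ‖(E : ℂ)‖ ≤ 1 := (norm_real E).trans_le hE
  rcases eq_or_ne E 0 with rfl | hE0
  · simpa using (hasDerivAt_id z).const_mul (D : ℂ)
  · simp only [hE0, if_false]
    have hlin : HasDerivAt (fun z : ℂ => 1 + E * z) E z := by
      simpa using ((hasDerivAt_id z).const_mul (E : ℂ)).const_add 1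
    refine ((hlin.clog (Or.inl (re_one_add_mul_pos hE' hz))).const_mul _).congr_deriv ?_
    have hEC : (E : ℂ) ≠ 0 := ofReal_ne_zero.2 hE0
    have hne := one_add_mul_ne_zero hE' hz
    push_cast
    field_simp

theorem differentiableOn_extremalLog (hE : |E| ≤ 1) :
    DifferentiableOn ℂ (extremalLog D E) unitDisk := fun _ hz =>
  (hasDerivAt_extremalLog hE hz).differentiableAt.differentiableWithinAt

theorem janowskiExtremal_eq_id_mul_exp (hE : |E| ≤ 1) {z : ℂ} (hz : z ∈ unitDisk) :
    janowskiExtremal D E z = z * exp (extremalLog D E z) := by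
  rw [janowskiExtremal, extremalLog]
  split_ifs
  · rfl
  · rw [cpow_def_of_ne_zero (one_add_mul_ne_zero ((norm_real E).trans_le hE) hz), mul_comm (log _)]

theorem janowskiExtremal_mem_starlikeClass (hE : |E| ≤ 1) :
    janowskiExtremal D E ∈ starlikeClass (janowskiPsi D E) := by
  have hlog := differentiableOn_extremalLog (D := D) hE
  have heq : Set.EqOn (janowskiExtremal D E) (fun z => z * exp (extremalLog D E z)) unitDisk :=
    fun z hz => janowskiExtremal_eq_id_mul_exp hE hz
  have h0 : (0 : ℂ) ∈ unitDisk := mem_ball_self one_pos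
  have hderiv : HasDerivAt (fun z => z * exp (extremalLog D E z)) 1 0 := by
    simpa [extremalLog_zero] using
      (hasDerivAt_id (0 : ℂ)).fun_mul (hasDerivAt_extremalLog (D := D) hE h0).cexp
  refine ⟨⟨(differentiableOn_id.fun_mul hlog.cexp).congr heq, by simp [heq h0], ?_⟩,
    fun z hz hz0 => ?_, id, differentiableOn_id, rfl, fun z hz => hz, fun z hz => ?_⟩
  · rw [(heq.eventuallyEq_of_mem unitDisk_mem_nhds_zero).deriv_eq, hderiv.deriv]
  · rw [heq hz]
    exact mul_ne_zero hz0 (exp_ne_zero _)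
  · rw [logDerivQuotient_eq_of_eq_id_mul_exp hlog heq hz, (hasDerivAt_extremalLog hE hz).deriv, id,
      janowskiPsi_eq_one_add hE hz]

/-- The self-map `v` solves `v' = (1 + E v) ℓ' / (D - E)`, which makes the derivatives agree. -/
theorem exists_eqOn_extremalLog_comp (hE : |E| ≤ 1) (hDE : D ≠ E) {ℓ w : ℂ → ℂ}
    (hℓ : DifferentiableOn ℂ ℓ unitDisk) (hℓ0 : ℓ 0 = 0) (hw : Set.MapsTo w unitDisk unitDisk)
    (hode : ∀ z ∈ unitDisk, z * deriv ℓ z * (1 + E * w z) = (D - E) * w z) :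
    ∃ v : ℂ → ℂ, DifferentiableOn ℂ v unitDisk ∧ v 0 = 0 ∧ Set.MapsTo v unitDisk unitDisk ∧
      Set.EqOn ℓ (fun z => extremalLog D E (v z)) unitDisk := by
  have hsub : (D - E : ℂ) ≠ 0 := sub_ne_zero.2 (ofReal_injective.ne hDE)
  have hE' : ‖(E : ℂ)‖ ≤ 1 := (norm_real E).trans_le hE
  obtain ⟨v, hv0, hv⟩ := exists_hasDerivAt_one_add_mul_mul_deriv (Λ := fun z => ℓ z / (D - E))
    (hℓ.div_const _) (by simp [hℓ0]) E
  simp only [deriv_div_const] at hv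
  have hvdiff : DifferentiableOn ℂ v unitDisk := fun z hz =>
    (hv z hz).differentiableAt.differentiableWithinAt
  have hvm : Set.MapsTo v unitDisk unitDisk := by
    refine mapsTo_unitDisk_of_mul_deriv_eq hE' hvdiff hv0 hw fun z hz => ?_
    rw [(hv z hz).deriv]
    field_simp
    linear_combination (1 + E * v z) * hode z hz
  have hcomp : ∀ z ∈ unitDisk, HasDerivAt (fun z => extremalLog D E (v z)) (deriv ℓ z) z := by
    intro z hz
    have hvz := one_add_mul_ne_zero hE' (hvm hz)
    refine ((hasDerivAt_extremalLog hE (hvm hz)).comp z (hv z hz)).congr_deriv ?_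
    field_simp
  refine ⟨v, hvdiff, hv0, hvm, ?_⟩
  exact isOpen_ball.eqOn_of_deriv_eq (convex_ball (0 : ℂ) 1).isPreconnected hℓ
    (fun z hz => (hcomp z hz).differentiableAt.differentiableWithinAt)
    (fun z hz => (hcomp z hz).deriv.symm) (mem_ball_self one_pos)
    (by simp [hℓ0, hv0, extremalLog_zero])

theorem subordinate_dslope_exp_extremalLog (hE : |E| ≤ 1) (hDE : D ≠ E) {f : ℂ → ℂ}
    (hf : f ∈ starlikeClass (janowskiPsi D E)) :
    Subordinate (dslope f 0) fun z => exp (extremalLog D E z) := by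
  obtain ⟨hfA, hne, w, -, -, hwm, hw⟩ := hf
  obtain ⟨ℓ, hℓ, hℓ0, hfℓ⟩ := exists_eq_id_mul_exp hfA hne
  have hode : ∀ z ∈ unitDisk, z * deriv ℓ z * (1 + E * w z) = (D - E) * w z := by
    intro z hz
    have hwz := one_add_mul_ne_zero ((norm_real E).trans_le hE) (hwm z hz)
    have h := hw z hz
    rw [logDerivQuotient_eq_of_eq_id_mul_exp hℓ hfℓ hz, janowskiPsi_eq_one_add hE (hwm z hz),
      add_right_inj] at h
    rw [h, mul_assoc, div_mul_cancel₀ _ hwz, mul_comm]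
  obtain ⟨v, hv, hv0, hvm, heq⟩ := exists_eqOn_extremalLog_comp hE hDE hℓ hℓ0 hwm hode
  refine ⟨v, hv, hv0, hvm, fun z hz => ?_⟩
  rcases eq_or_ne z 0 with rfl | hz0
  · simp [hfA.2.2, hv0, extremalLog_zero]
  · have hz := heq hz ▸ hfℓ z hz
    rw [dslope_of_ne _ hz0, slope_def_field, hfA.2.1, hz, sub_zero, sub_zero,
      mul_div_cancel_left₀ _ hz0]

end JanowskiFunction

section BohrPhenomenon

variable {f : ℂ → ℂ} {r s : ℝ}

theorem majorant_le_majorant_of_le (hf : DifferentiableOn ℂ f unitDisk) (h0 : 0 ≤ r) (hrs : r ≤ s)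
    (h1 : s < 1) : majorant f r ≤ majorant f s :=
  Summable.tsum_le_tsum (fun k => by gcongr)
    (summable_norm_taylorCoeff_succ hf h0 (hrs.trans_lt h1))
    (summable_norm_taylorCoeff_succ hf (h0.trans hrs) h1)

open scoped ComplexOrder in
theorem ofReal_majorant_of_taylorCoeff_nonneg (hf : DifferentiableOn ℂ f unitDisk) (hf0 : f 0 = 0)
    (hpos : ∀ k, 0 ≤ taylorCoeff f (k + 1)) (h0 : 0 ≤ r) (h1 : r < 1) :
    (majorant f r : ℂ) = f r := by
  have hr : (r : ℂ) ∈ unitDisk := by simpa [abs_of_nonneg h0] using h1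
  have hsum := (hasSum_nat_add_iff' 1).2 (hasSum_taylorCoeff hf hr)
  rw [Finset.sum_range_one, taylorCoeff_zero, hf0, zero_mul, sub_zero] at hsum
  rw [majorant, ofReal_tsum, ← hsum.tsum_eq]
  refine tsum_congr fun k => ?_
  rw [ofReal_mul, ofReal_pow, norm_of_nonneg' (hpos k)]

theorem bohrPhenomenon_subordinants (hf : DifferentiableOn ℂ f unitDisk) (hf0 : f 0 = 0)
    (hr : r ≤ 1 / 3) (hle : majorant f r ≤ boundaryDist f) :
    BohrPhenomenon f (subordinants f) r := fun g hg z hz hzr =>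
  ⟨summable_norm_taylorCoeff_succ hg.1 (norm_nonneg z) (mem_ball_zero_iff.1 hz),
    calc majorant g ‖z‖ ≤ majorant f ‖z‖ :=
          majorant_le_of_subordinate hf hf0 hg.1 hg.2 (norm_nonneg z) (hzr.trans hr)
      _ ≤ majorant f r := majorant_le_majorant_of_le hf (norm_nonneg z) hzr (by linarith)
      _ ≤ boundaryDist f := hle⟩

theorem le_of_bohrPhenomenon_singleton (hs : s ≤ 1) (h0 : 0 ≤ r)
    (hfail : ∀ t ∈ Set.Ioo r 1, boundaryDist f < majorant f t) (hB : BohrPhenomenon f {f} s) :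
    s ≤ r := by
  by_contra! hlt
  obtain ⟨t, hrt, hts⟩ := exists_between hlt
  have hnorm : ‖(t : ℂ)‖ = t := by rw [norm_real, Real.norm_of_nonneg (h0.trans hrt.le)]
  have hle := (hB f rfl t (mem_ball_zero_iff.2 (hnorm.trans_lt (hts.trans_le hs)))
    (hnorm.trans_le hts.le)).2
  rw [hnorm] at hle
  exact (hfail t ⟨hrt, hts.trans_le hs⟩).not_ge hle

theorem sharpBohr_of_forall_bohrPhenomenon {ψ : ℂ → ℂ} (hf : f ∈ starlikeClass ψ)
    (hr : r ∈ Set.Ioo (0 : ℝ) 1)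
    (hB : ∀ g ∈ starlikeClass ψ, BohrPhenomenon g (subordinants g) r)
    (heq : majorant f r = boundaryDist f)
    (hfail : ∀ t ∈ Set.Ioo r 1, boundaryDist f < majorant f t) : SharpBohr ψ f r := by
  have singleton_subset {g : ℂ → ℂ} (hg : g ∈ starlikeClass ψ) : {g} ⊆ subordinants g :=
    Set.singleton_subset_iff.2 (mem_subordinants_self hg.1.1)
  have hr' : r ∈ Set.Ioc (0 : ℝ) 1 := ⟨hr.1, hr.2.le⟩
  have upper {s : ℝ} (hs : s ∈ Set.Ioc (0 : ℝ) 1) (h : BohrPhenomenon f {f} s) : s ≤ r :=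
    le_of_bohrPhenomenon_singleton hs.2 hr.1.le hfail h
  exact ⟨⟨⟨hr', hB⟩, fun s hs => upper hs.1 fun g hg => hs.2 f hf g (singleton_subset hf hg)⟩,
    ⟨⟨hr', fun g hg h hh => hB g hg h (singleton_subset hg hh)⟩,
      fun s hs => upper hs.1 (hs.2 f hf)⟩, hf, heq, hfail⟩

end BohrPhenomenon

section RealAxis

variable {D E x : ℝ}

theorem one_add_mul_pos (hE : |E| ≤ 1) (hx : |x| < 1) : 0 < 1 + E * x := by
  have hlt : |E * x| < 1 := by
    rw [abs_mul]
    exact mul_lt_one_of_nonneg_of_lt_one_right hE (abs_nonneg x) hx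
  linarith [(abs_lt.1 hlt).1]

open Classical in
/-- The logarithm of `f₀(x) / x` at the real points `x` with `1 + E x > 0`, where it agrees with
`extremalLog`. -/
noncomputable def realExtremalLog (D E x : ℝ) : ℝ :=
  if E = 0 then D * x else (D - E) / E * Real.log (1 + E * x)

/-- The function `f₀` at the real points `x` with `1 + E x > 0`; unlike in the disk, `x = -1` and
`1 ≤ x` are allowed. -/
noncomputable def realExtremal (D E x : ℝ) : ℝ :=
  x * Real.exp (realExtremalLog D E x)

theorem realExtremal_neg_one (D E : ℝ) :
    realExtremal D E (-1) = -Real.exp (realExtremalLog D E (-1)) :=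
  neg_one_mul _

theorem realExtremal_eq_mul_rpow (hE : E ≠ 0) (hx : 0 < 1 + E * x) :
    realExtremal D E x = x * (1 + E * x) ^ ((D - E) / E) := by
  rw [realExtremal, realExtremalLog, if_neg hE, Real.rpow_def_of_pos hx, mul_comm (Real.log _)]

theorem realExtremal_zero_right (D x : ℝ) : realExtremal D 0 x = x * Real.exp (D * x) := by
  rw [realExtremal, realExtremalLog, if_pos rfl]

theorem extremalLog_ofReal (hx : 0 < 1 + E * x) : extremalLog D E x = realExtremalLog D E x := by
  rw [extremalLog, realExtremalLog]
  split_ifs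
  · rw [ofReal_mul]
  · rw [ofReal_mul, ofReal_log hx.le, ofReal_add, ofReal_one, ofReal_mul]

theorem janowskiExtremal_ofReal (hE : |E| ≤ 1) (hx : |x| < 1) :
    janowskiExtremal D E x = realExtremal D E x := by
  rw [janowskiExtremal_eq_id_mul_exp hE (by simpa using hx),
    extremalLog_ofReal (one_add_mul_pos hE hx), realExtremal, ofReal_mul, ofReal_exp]

theorem hasDerivAt_realExtremalLog (hx : 0 < 1 + E * x) :
    HasDerivAt (realExtremalLog D E) ((D - E) / (1 + E * x)) x := by
  unfold realExtremalLog
  rcases eq_or_ne E 0 with rfl | hE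
  · simpa using (hasDerivAt_id x).const_mul D
  · simp only [hE, if_false]
    have hlin : HasDerivAt (fun x : ℝ => 1 + E * x) E x := by
      simpa using ((hasDerivAt_id x).const_mul E).const_add 1
    refine ((hlin.log hx.ne').const_mul ((D - E) / E)).congr_deriv ?_
    field_simp

theorem hasDerivAt_realExtremal (hx : 0 < 1 + E * x) :
    HasDerivAt (realExtremal D E)
      (Real.exp (realExtremalLog D E x) * ((1 + D * x) / (1 + E * x))) x := by
  refine ((hasDerivAt_id x).fun_mul (hasDerivAt_realExtremalLog hx).exp).congr_deriv ?_
  rw [id, one_add_mul_div_one_add_mul hx.ne']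
  ring

theorem strictMonoOn_realExtremal (hED : E ≤ D) :
    StrictMonoOn (realExtremal D E) {x | 0 ≤ x ∧ 0 < 1 + E * x} := by
  have hconvex : Convex ℝ {x | 0 < 1 + E * x} := by
    simpa only [neg_lt_iff_pos_add', smul_eq_mul] using
      convex_halfSpace_gt (IsLinearMap.isLinearMap_smul E) (-1 : ℝ)
  refine strictMonoOn_of_deriv_pos ((convex_Ici 0).inter hconvex)
    (fun x hx => (hasDerivAt_realExtremal hx.2).continuousAt.continuousWithinAt) fun x hx => ?_
  obtain ⟨(hx0 : 0 ≤ x), (hEx : 0 < 1 + E * x)⟩ := interior_subset hx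
  rw [(hasDerivAt_realExtremal hEx).deriv]
  have hDx : 0 < 1 + D * x := by linarith [mul_le_mul_of_nonneg_right hED hx0]
  positivity

theorem realExtremalLog_neg_one_le_re (hE : -1 ≤ E) (hE1 : E < 1) (hED : E ≤ D) {z : ℂ}
    (hz : z ∈ unitDisk) : realExtremalLog D E (-1) ≤ (extremalLog D E z).re := by
  have hz1 : ‖z‖ < 1 := mem_ball_zero_iff.1 hz
  have hE' : ‖(E : ℂ)‖ ≤ 1 := (norm_real E).trans_le (abs_le.2 ⟨hE, hE1.le⟩)
  rw [extremalLog, realExtremalLog]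
  split_ifs with h0
  · rw [re_ofReal_mul]
    nlinarith [(abs_le.1 (abs_re_le_norm z)).1]
  · rw [re_ofReal_mul, log_re]
    have hpos : 0 < ‖1 + (E : ℂ) * z‖ := norm_pos_iff.2 (one_add_mul_ne_zero hE' hz)
    have hEz : ‖(E : ℂ) * z‖ ≤ |E| := by
      rw [norm_mul, norm_real, Real.norm_eq_abs]
      exact mul_le_of_le_one_right (abs_nonneg E) hz1.le
    rcases lt_or_gt_of_ne h0 with hneg | hpos'
    · have upper : ‖1 + (E : ℂ) * z‖ ≤ 1 + E * -1 := by
        refine (norm_add_le _ _).trans ?_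
        rw [abs_of_neg hneg] at hEz
        rw [norm_one]
        linarith
      exact mul_le_mul_of_nonpos_left (Real.log_le_log hpos upper)
        (div_nonpos_of_nonneg_of_nonpos (sub_nonneg.2 hED) hneg.le)
    · have lower : 1 + E * -1 ≤ ‖1 + (E : ℂ) * z‖ := by
        have h := norm_sub_le (1 + (E : ℂ) * z) (E * z)
        rw [add_sub_cancel_right, norm_one] at h
        rw [abs_of_pos hpos'] at hEz
        linarith
      exact mul_le_mul_of_nonneg_left (Real.log_le_log (by linarith) lower)
        (div_nonneg (sub_nonneg.2 hED) hpos'.le)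

theorem exists_realExtremal_eq_iff {δ : ℝ} (hE : -1 ≤ E) (hED : E ≤ D) (hδ : 0 < δ) {s : ℝ}
    (hs : s < 1) (h : δ ≤ realExtremal D E s) :
    ∃ r₀ ∈ Set.Ioc 0 s, ∀ r, 0 < 1 + E * r → (realExtremal D E r = δ ↔ r = r₀) := by
  have pos_of_eq {r : ℝ} (hr : δ ≤ realExtremal D E r) : 0 < r :=
    (mul_pos_iff_of_pos_right (Real.exp_pos _)).1 (hδ.trans_le hr)
  have hs0 : 0 ≤ s := (pos_of_eq h).le
  have hpos : ∀ x ∈ Set.Icc 0 s, 0 < 1 + E * x := fun x hx => by nlinarith [hx.1, hx.2]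
  have hcont : ContinuousOn (realExtremal D E) (Set.Icc 0 s) := fun x hx =>
    (hasDerivAt_realExtremal (hpos x hx)).continuousAt.continuousWithinAt
  obtain ⟨r₀, hr₀, hval⟩ := intermediate_value_Icc hs0 hcont
    ⟨by rw [realExtremal, zero_mul]; exact hδ.le, h⟩
  refine ⟨r₀, ⟨pos_of_eq hval.ge, hr₀.2⟩, fun r hr => ⟨fun heq => ?_, fun heq => heq ▸ hval⟩⟩
  exact (strictMonoOn_realExtremal hED).injOn ⟨(pos_of_eq heq.ge).le, hr⟩
    ⟨hr₀.1, hpos r₀ hr₀⟩ (heq.trans hval.symm)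

end RealAxis

section BohrRadius

variable {D E r : ℝ}

theorem neg_realExtremal_neg_one_le_boundaryDist (hE : -1 ≤ E) (hED : E < D) (hD : D ≤ 1)
    {f : ℂ → ℂ} (hf : f ∈ starlikeClass (janowskiPsi D E)) :
    -realExtremal D E (-1) ≤ boundaryDist f := by
  have hE' : |E| ≤ 1 := abs_le.2 ⟨hE, (hED.trans_le hD).le⟩
  have hD' : |D| ≤ 1 := abs_le.2 ⟨hE.trans hED.le, hD⟩
  rw [realExtremal_neg_one, neg_neg]
  refine le_boundaryDist_of_mem_starlikeClass (fun w hw => re_janowskiPsi_pos hE' hD' hw) hf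
    (Real.exp_pos _) fun z hz => ?_
  obtain ⟨v, -, -, hvm, hv⟩ := subordinate_dslope_exp_extremalLog hE' hED.ne' hf
  rw [← add_mul_dslope_zero f z, hf.1.2.1, zero_add, norm_mul, hv z hz, norm_exp]
  gcongr
  exact realExtremalLog_neg_one_le_re hE (hED.trans_le hD) hED.le (hvm z hz)

theorem tendsto_janowskiExtremal_neg (hE : |E| ≤ 1) (hE1 : E < 1) :
    Tendsto (fun r : ℝ => janowskiExtremal D E (-r)) (𝓝[<] 1) (𝓝 (realExtremal D E (-1))) := by
  have hcont : ContinuousAt (realExtremal D E) (-1) :=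
    (hasDerivAt_realExtremal (by linarith)).continuousAt
  have hlim : Tendsto (fun r : ℝ => (realExtremal D E (-r) : ℂ)) (𝓝[<] 1)
      (𝓝 (realExtremal D E (-1) : ℂ)) :=
    (continuous_ofReal.tendsto _).comp
      (hcont.tendsto.comp ((continuous_neg.tendsto 1).mono_left nhdsWithin_le_nhds))
  refine hlim.congr' ?_
  filter_upwards [Ioo_mem_nhdsLT (zero_lt_one' ℝ)] with r hr
  rw [← janowskiExtremal_ofReal hE (by rw [abs_neg, abs_of_pos hr.1]; exact hr.2), ofReal_neg]

theorem boundaryDist_janowskiExtremal (hE : -1 ≤ E) (hED : E < D) (hD : D ≤ 1) :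
    boundaryDist (janowskiExtremal D E) = -realExtremal D E (-1) := by
  have hE' : |E| ≤ 1 := abs_le.2 ⟨hE, (hED.trans_le hD).le⟩
  have hψ : ∀ w ∈ unitDisk, 0 < (janowskiPsi D E w).re := fun w hw =>
    re_janowskiPsi_pos hE' (abs_le.2 ⟨hE.trans hED.le, hD⟩) hw
  have hf := janowskiExtremal_mem_starlikeClass (D := D) hE'
  refine le_antisymm ?_ (neg_realExtremal_neg_one_le_boundaryDist hE hED hD hf)
  have hnear : ∀ᶠ r : ℝ in 𝓝[<] 1, (-r : ℂ) ∈ unitDisk := by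
    filter_upwards [Ioo_mem_nhdsLT (zero_lt_one' ℝ)] with r hr
    simpa [abs_of_pos hr.1] using hr.2
  have hnorm : Tendsto (fun r : ℝ => ‖(-r : ℂ)‖) (𝓝[<] 1) (𝓝 1) := by
    have hcont : Continuous fun r : ℝ => ‖(-r : ℂ)‖ := by fun_prop
    simpa using (hcont.tendsto 1).mono_left nhdsWithin_le_nhds
  have hfrontier := mem_frontier_of_tendsto hf.1.1
    (fun _ hz => deriv_ne_zero_of_mem_starlikeClass hψ hf hz) (injOn_of_mem_starlikeClass hψ hf)
    hnear hnorm (tendsto_janowskiExtremal_neg hE' (hED.trans_le hD))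
  refine (infDist_le_dist_of_mem hfrontier).trans_eq ?_
  rw [hf.1.2.1, dist_zero_left, norm_real, realExtremal_neg_one, norm_neg, neg_neg,
    Real.norm_of_nonneg (Real.exp_pos _).le]

theorem majorant_le_majorant_janowskiExtremal (hE : |E| ≤ 1) (hDE : D ≠ E) {f : ℂ → ℂ}
    (hf : f ∈ starlikeClass (janowskiPsi D E)) (h0 : 0 ≤ r) (hr : r ≤ 1 / 3) :
    majorant f r ≤ majorant (janowskiExtremal D E) r := by
  have hfactor : (fun z => z * dslope f 0 z) = f := by
    funext z
    rw [← add_mul_dslope_zero f z, hf.1.2.1, zero_add]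
  have hcoeff : taylorCoeff (janowskiExtremal D E) =
      taylorCoeff fun z => z * exp (extremalLog D E z) :=
    taylorCoeff_congr fun z hz => janowskiExtremal_eq_id_mul_exp hE hz
  calc majorant f r = majorant (fun z => z * dslope f 0 z) r := by rw [hfactor]
    _ ≤ majorant (fun z => z * exp (extremalLog D E z)) r :=
      majorant_id_mul_le_of_subordinate (differentiableOn_extremalLog hE).cexp
        (differentiableOn_dslope_zero hf.1.1) (subordinate_dslope_exp_extremalLog hE hDE hf) h0 hr
    _ = majorant (janowskiExtremal D E) r := by simp only [majorant, hcoeff]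

open scoped ComplexOrder in
theorem majorant_janowskiExtremal (hE : |E| ≤ 1)
    (ht : ∀ n : ℕ, 2 ≤ n → 0 ≤ taylorCoeff (janowskiExtremal D E) n) (h0 : 0 ≤ r) (h1 : r < 1) :
    majorant (janowskiExtremal D E) r = realExtremal D E r := by
  obtain ⟨hdiff, hzero, hderiv⟩ := (janowskiExtremal_mem_starlikeClass (D := D) hE).1
  have hpos : ∀ k, 0 ≤ taylorCoeff (janowskiExtremal D E) (k + 1)
    | 0 => by simp [taylorCoeff, hderiv]
    | k + 1 => ht _ (by omega)
  have h := ofReal_majorant_of_taylorCoeff_nonneg hdiff hzero hpos h0 h1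
  rwa [janowskiExtremal_ofReal hE (by rwa [abs_of_nonneg h0]), ofReal_inj] at h

open scoped ComplexOrder in
theorem sharpBohr_janowski (hE : -1 ≤ E) (hED : E < D) (hD : D ≤ 1)
    (ht : ∀ n : ℕ, 2 ≤ n → 0 ≤ taylorCoeff (janowskiExtremal D E) n) (h0 : 0 < r)
    (h3 : r ≤ 1 / 3) (hr : realExtremal D E r = -realExtremal D E (-1)) :
    SharpBohr (janowskiPsi D E) (janowskiExtremal D E) r := by
  have hE' : |E| ≤ 1 := abs_le.2 ⟨hE, (hED.trans_le hD).le⟩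
  have hr1 : r < 1 := by linarith
  have hmaj {s : ℝ} (hs0 : 0 ≤ s) (hs1 : s < 1) :
      majorant (janowskiExtremal D E) s = realExtremal D E s :=
    majorant_janowskiExtremal hE' ht hs0 hs1
  have hdom {s : ℝ} (hs0 : 0 ≤ s) (hs1 : s < 1) : s ∈ {x | 0 ≤ x ∧ 0 < 1 + E * x} :=
    ⟨hs0, one_add_mul_pos hE' (by rwa [abs_of_nonneg hs0])⟩
  refine sharpBohr_of_forall_bohrPhenomenon (janowskiExtremal_mem_starlikeClass hE') ⟨h0, hr1⟩
    (fun f hf => bohrPhenomenon_subordinants hf.1.1 hf.1.2.1 h3 ?_) ?_ fun s hs => ?_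
  · calc majorant f r ≤ majorant (janowskiExtremal D E) r :=
          majorant_le_majorant_janowskiExtremal hE' hED.ne' hf h0.le h3
      _ = -realExtremal D E (-1) := by rw [hmaj h0.le hr1, hr]
      _ ≤ boundaryDist f := neg_realExtremal_neg_one_le_boundaryDist hE hED hD hf
  · rw [hmaj h0.le hr1, hr, boundaryDist_janowskiExtremal hE hED hD]
  · have hs0 : 0 ≤ s := h0.le.trans hs.1.le
    rw [boundaryDist_janowskiExtremal hE hED hD, ← hr, hmaj hs0 hs.2]
    exact strictMonoOn_realExtremal hED.le (hdom h0.le hr1) (hdom hs0 hs.2) hs.1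

open scoped ComplexOrder in
theorem exists_sharpBohr_janowski (hE : -1 ≤ E) (hED : E < D) (hD : D ≤ 1)
    (ht : ∀ n : ℕ, 2 ≤ n → 0 ≤ taylorCoeff (janowskiExtremal D E) n)
    (h3 : -realExtremal D E (-1) ≤ realExtremal D E (1 / 3)) :
    ∃ r₀ ∈ Set.Ioo (0 : ℝ) 1,
      (∀ r, 0 < 1 + E * r → (realExtremal D E r = -realExtremal D E (-1) ↔ r = r₀)) ∧
      SharpBohr (janowskiPsi D E) (janowskiExtremal D E) r₀ := by
  have hδ : 0 < -realExtremal D E (-1) := by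
    rw [realExtremal_neg_one, neg_neg]
    exact Real.exp_pos _
  obtain ⟨r₀, hr₀, hiff⟩ := exists_realExtremal_eq_iff hE hED.le hδ (by norm_num) h3
  have hr₀1 : r₀ < 1 := by linarith [hr₀.2]
  have hdom : 0 < 1 + E * r₀ := by nlinarith [hr₀.1]
  exact ⟨r₀, ⟨hr₀.1, hr₀1⟩, hiff,
    sharpBohr_janowski hE hED hD ht hr₀.1 hr₀.2 ((hiff r₀ hdom).2 rfl)⟩

end BohrRadius

section ExponentialCase

variable {D : ℝ}

theorem taylorCoeff_janowskiExtremal_zero_right (D : ℝ) (k : ℕ) :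
    taylorCoeff (janowskiExtremal D 0) (k + 1) = ((D ^ k / k.factorial : ℝ) : ℂ) := by
  have heq : janowskiExtremal D 0 = fun z => z * exp (D * z) := by
    funext z
    rw [janowskiExtremal, if_pos rfl]
  have hexp : AnalyticAt ℂ (fun z => exp (D * z)) 0 := by fun_prop
  rw [heq, taylorCoeff_id_mul_succ hexp, taylorCoeff, iteratedDeriv_cexp_const_mul]
  simp

open scoped ComplexOrder in
theorem taylorCoeff_janowskiExtremal_zero_right_nonneg (hD : 0 ≤ D) {n : ℕ} (hn : n ≠ 0) :
    0 ≤ taylorCoeff (janowskiExtremal D 0) n := by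
  obtain ⟨k, rfl⟩ := Nat.exists_eq_succ_of_ne_zero hn
  rw [Nat.succ_eq_add_one, taylorCoeff_janowskiExtremal_zero_right, zero_le_real]
  positivity

theorem neg_realExtremal_zero_right_le (h : 3 / 4 * Real.log 3 ≤ D) :
    -realExtremal D 0 (-1) ≤ realExtremal D 0 (1 / 3) := by
  have h3 : 3 ≤ Real.exp (4 / 3 * D) :=
    (Real.log_le_iff_le_exp (by norm_num)).1 (by linarith)
  have hmul : Real.exp (D * (1 / 3)) = Real.exp (4 / 3 * D) * Real.exp (D * -1) := by
    rw [← Real.exp_add]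
    ring_nf
  rw [realExtremal_zero_right, realExtremal_zero_right, hmul]
  nlinarith [Real.exp_pos (D * -1)]

theorem realExtremal_zero_right_eq_iff (D r : ℝ) :
    realExtremal D 0 r = -realExtremal D 0 (-1) ↔ 1 - r * Real.exp (D * (1 + r)) = 0 := by
  have hne := Real.exp_ne_zero D
  rw [realExtremal_zero_right, realExtremal_zero_right, neg_one_mul, neg_neg, mul_neg_one,
    Real.exp_neg, ← mul_eq_one_iff_eq_inv₀ hne, sub_eq_zero, eq_comm, mul_add, mul_one,
    Real.exp_add, mul_comm (Real.exp D), mul_assoc]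

end ExponentialCase

end JanowskiBohr

open JanowskiBohr in
open scoped ComplexOrder in
theorem mainTheorem10 (D E : ℝ) (hE : -1 ≤ E) (hED : E < D) (hD : D ≤ 1) :
    (E = 0 → 3 / 4 * Real.log 3 ≤ D →
      ∃ r₀ ∈ Set.Ioo (0 : ℝ) 1,
        (∀ r : ℝ, 1 - r * Real.exp (D * (1 + r)) = 0 ↔ r = r₀) ∧
        SharpBohr (janowskiPsi D E) (janowskiExtremal D E) r₀) ∧
    (E ≠ 0 → (∀ n : ℕ, 2 ≤ n → 0 ≤ taylorCoeff (janowskiExtremal D E) n) →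
      3 * (1 - E) ^ ((D - E) / E) ≤ (1 + E / 3) ^ ((D - E) / E) →
      ∃ r₀ ∈ Set.Ioo (0 : ℝ) 1,
        (∀ r : ℝ, 0 < 1 + E * r →
          ((1 - E) ^ ((D - E) / E) - r * (1 + E * r) ^ ((D - E) / E) = 0 ↔ r = r₀)) ∧
        SharpBohr (janowskiPsi D E) (janowskiExtremal D E) r₀) := by
  constructor
  · rintro rfl hlog
    obtain ⟨r₀, hr₀, hiff, hsharp⟩ := exists_sharpBohr_janowski hE hED hD
      (fun n hn => taylorCoeff_janowskiExtremal_zero_right_nonneg hED.le (by omega))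
      (neg_realExtremal_zero_right_le hlog)
    refine ⟨r₀, hr₀, fun r => ?_, hsharp⟩
    rw [← realExtremal_zero_right_eq_iff, hiff r (by norm_num)]
  · intro hE0 ht hpow
    have hneg : -realExtremal D E (-1) = (1 - E) ^ ((D - E) / E) := by
      rw [realExtremal_eq_mul_rpow hE0 (by linarith), neg_one_mul, neg_neg, mul_neg_one,
        ← sub_eq_add_neg]
    have hthird : realExtremal D E (1 / 3) = 1 / 3 * (1 + E / 3) ^ ((D - E) / E) := by
      rw [realExtremal_eq_mul_rpow hE0 (by linarith), mul_one_div]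
    obtain ⟨r₀, hr₀, hiff, hsharp⟩ := exists_sharpBohr_janowski hE hED hD ht
      (by rw [hneg, hthird]; linarith)
    refine ⟨r₀, hr₀, fun r hr => ?_, hsharp⟩
    rw [← hiff r hr, hneg, realExtremal_eq_mul_rpow hE0 hr, sub_eq_zero, eq_comm]
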